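/- Notation. $|\cdot|$ is the Euclidean norm on $\mathbb{R}^d$, $S^{d-1}$ the Euclidean unit sphere, $e_1,\dots,e_d$ the standard basis, and $\mathrm{absconv}(A)=\mathrm{conv}(A\cup -A)$. A convex body is a convex compact set with non-empty interior. For convex bodies $K_1,K_2\subset\mathbb{R}^d$ the Banach–Mazur distance is $$d(K_1,K_2)=\inf\{\lambda>0 \mid K_1-a\subset T(K_2-b)\subset\lambda(K_1-a)\},$$ the infimum being over all invertible linear $T:\mathbb{R}^d\to\mathbb{R}^d$ and all $a,b\in\mathbb{R}^d$. Let $d\ge 1$ and $2d\le M\le e^d$ be integers, and put $\ell=\lceil\log_5(M/d)\rceil$. Decompose $\{1,\dots,d\}$ into consecutive disjoint intervals $I_1,\dots,I_{\lceil d/\ell\rceil}$, each, except possibly the last one, consisting of $\ell$ numbers. For every $k$ let $\mathcal N_k\subset S^{d-1}\cap\mathbb{R}^{I_k}$ be a $(1/2)$-net of $S^{d-1}\cap\mathbb{R}^{I_k}$ in the Euclidean metric, of cardinality at most $5^\ell$. Let $X_1,\dots,X_M$ be independent random vectors uniformly distributed on $S^{d-1}$. The Gluskin polytope is $$V_M=\mathrm{absconv}\Big(\{e_1,\dots,e_d\}\cup\bigcup_{k=1}^{\lceil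 d/\ell\rceil}\mathcal N_k\cup\{X_1,\dots,X_M\}\Big).$$ Corollary. There is an absolute constant $C>0$ such that for all integers $d\ge1$ and $M$ with $2d\le M\le e^d$, every choice of the nets $\mathcal N_k$ as above, and every convex body $K\subset\mathbb{R}^d$, $$\mathbb P\left(d(V_M,K)\le C\sqrt{\frac{d}{\ln (M/d)}}\right)\le\sqrt2\,e^{-dM/2}.$$ -/

import Mathlib

open MeasureTheory ProbabilityTheory

namespace Gluskin

noncomputable section

/-- `ℝ^d` with its canonical Euclidean norm. -/
abbrev E (d : ℕ) : Type := EuclideanSpace ℝ (Fin d)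

/-- A convex body in `ℝ^d`: a convex compact set with non-empty interior. -/
structure IsConvexBody {d : ℕ} (K : Set (E d)) : Prop where
  convex : Convex ℝ K
  isCompact : IsCompact K
  interior_nonempty : (interior K).Nonempty

/-- The absolute convex hull `conv (A ∪ -A)`. -/
def absconv {d : ℕ} (A : Set (E d)) : Set (E d) :=
  convexHull ℝ (A ∪ {x | -x ∈ A})

/-- The Banach-Mazur distance of two (not necessarily symmetric) convex bodies: the infimum of
all `lam > 0` with `K₁ - a ⊆ T (K₂ - b) ⊆ lam (K₁ - a)` for some invertible linear `T` and some
`a, b ∈ ℝ^d`. For convex bodies the set of such `lam` is non-empty. -/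
def banachMazurDist {d : ℕ} (K₁ K₂ : Set (E d)) : ℝ :=
  sInf {lam : ℝ | 0 < lam ∧ ∃ (T : E d ≃ₗ[ℝ] E d) (a b : E d),
    (fun x => x - a) '' K₁ ⊆ (fun x => T (x - b)) '' K₂ ∧
    (fun x => T (x - b)) '' K₂ ⊆ (fun x => lam • (x - a)) '' K₁}

/-- The unit sphere `S^{d-1}` of `ℝ^d`. -/
abbrev S (d : ℕ) : Set (E d) := Metric.sphere (0 : E d) 1

/-- The rotation invariant probability measure on `S^{d-1}` (normalized surface measure). -/
def sphereUniform (d : ℕ) : Measure (S d) :=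
  ((volume : Measure (E d)).toSphere Set.univ)⁻¹ • (volume : Measure (E d)).toSphere

/-- The block length `ℓ = ⌈log_5 (M / d)⌉`. -/
def blockLength (d M : ℕ) : ℕ := ⌈Real.logb 5 ((M : ℝ) / d)⌉₊

/-- The number of blocks `⌈d / ℓ⌉`. -/
def numBlocks (d M : ℕ) : ℕ := ⌈(d : ℝ) / (blockLength d M : ℝ)⌉₊

/-- The `k`-th of the consecutive intervals of coordinates, each (except possibly the last one)
consisting of `ℓ` numbers. Coordinates and blocks are numbered from `0`. -/
def block (d M : ℕ) (k : ℕ) : Set (Fin d) :=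
  {i | k * blockLength d M ≤ (i : ℕ) ∧ (i : ℕ) < (k + 1) * blockLength d M}

/-- The unit sphere `S^{d-1} ∩ ℝ^I` of the coordinate subspace of vectors supported on `I`. -/
def coordSphere {d : ℕ} (I : Set (Fin d)) : Set (E d) :=
  {x | x ∈ S d ∧ ∀ i, i ∉ I → x i = 0}

/-- `N k` is, for each block `k`, a `1/2`-net of the unit sphere of the `k`-th coordinate
subspace, contained in that sphere, with at most `5^ℓ` elements. -/
structure IsNetFamily (d M : ℕ) (N : Fin (numBlocks d M) → Finset (E d)) : Prop where
  subset : ∀ k : Fin (numBlocks d M), (N k : Set (E d)) ⊆ coordSphere (block d M k)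
  net : ∀ k : Fin (numBlocks d M), ∀ x ∈ coordSphere (block d M k), ∃ y ∈ N k, dist x y ≤ 1 / 2
  card_le : ∀ k : Fin (numBlocks d M), (N k).card ≤ 5 ^ blockLength d M

/-- The Gluskin polytope with auxiliary nets `N k` and sphere vertices `x 0, …, x (M - 1)`:
the absolute convex hull of the standard basis, all the nets, and the points `x j`. -/
def polytope {d M : ℕ} (N : Fin (numBlocks d M) → Finset (E d)) (x : Fin M → S d) : Set (E d) :=
  absconv ((Set.range fun i : Fin d => EuclideanSpace.single i (1 : ℝ)) ∪
    (⋃ k, (N k : Set (E d))) ∪ Set.range fun j => (x j : E d))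

end

end Gluskin

namespace Gluskin

open scoped Pointwise

/-! Take two independent copies `x`, `x'` of the random vertices. If both polytopes are at distance
less than `ρ` from the same `K`, composing the two positions of `K` gives mutually inverse
operators, one mapping the first polytope into `ρ` times the second, the other doing the reverse;
translations drop out by symmetry. One of them has determinant at least 1 in absolute value. So the
square of the sought probability is at most twice the probability that, for fixed `x'`, some `T`
with `1 ≤ |T.det|` sends all `e_i` and `x_j` into `W = ρ • polytope N x'`
(`mem_embeddingPairs_or_swap`, `measure_banachMazurDist_lt_le`).

That event is bounded by a union bound (`measure_exists_operator_le`). With `L = log (M / d)`, the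
block nets put a ball of radius `s = ρ √(L/d) / 4` inside `W`, while Maurey's method shows that `W`
has at most the volume of a ball of radius `A s`, with `A` absolute. Operators with columns in `W`
are covered by at most `2 (80 A)^(d²)` operator-norm balls, and each fixed operator sends all `M`
random points into `2 W` with probability at most `(2 A s)^(d M)`. As `d ≤ M`, the product is at
most `(320 A² s)^(d M)`; choosing `ρ` of order `√(d/L)` makes the base `e⁻¹`. -/

/-! ### Packing and covering; the volume of the Euclidean ball -/

/-- A maximal family of disjoint translates of `W` inside `Z`, and the covering it yields. -/
theorem exists_finset_translates_cover {G : Type*} [AddCommGroup G] [MeasurableSpace G]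
    [MeasurableAdd G] (μ : Measure G) [μ.IsAddLeftInvariant] {A Z W : Set G}
    (hW : MeasurableSet W) (hμW : μ W ≠ 0) (hZ : μ Z ≠ ⊤)
    (hsub : ∀ t ∈ A, ∀ w ∈ W, t + w ∈ Z) :
    ∃ F : Finset G, (F : Set G) ⊆ A ∧ F.card * μ W ≤ μ Z ∧
      ∀ t ∈ A, ∃ s ∈ F, ∃ w ∈ W, ∃ w' ∈ W, t + w = s + w' := by
  classical
  have hbound : ∀ F : Finset G, (F : Set G) ⊆ A →
      (F : Set G).PairwiseDisjoint (fun t => (fun x => -t + x) ⁻¹' W) →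
      F.card * μ W ≤ μ Z := by
    intro F hFA hF
    have h1 : μ (⋃ t ∈ F, (fun x => -t + x) ⁻¹' W) = ∑ t ∈ F, μ ((fun x => -t + x) ⁻¹' W) :=
      measure_biUnion_finset hF fun t _ => measurable_const_add (-t) hW
    have h2 : ∑ t ∈ F, μ ((fun x => -t + x) ⁻¹' W) = F.card * μ W := by
      simp [measure_preimage_add]
    rw [← h2, ← h1]
    refine measure_mono (Set.iUnion₂_subset fun t ht x hx => ?_)
    simpa using hsub t (hFA ht) _ hx
  -- If no packing were maximal, packings would grow to any size, against the volume bound.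
  by_contra! hcon
  have hall : ∀ n : ℕ, ∃ F : Finset G, (F : Set G) ⊆ A ∧
      (F : Set G).PairwiseDisjoint (fun t => (fun x => -t + x) ⁻¹' W) ∧ F.card = n := by
    intro n
    induction n with
    | zero => exact ⟨∅, by simp, by simp, by simp⟩
    | succ n ih =>
      obtain ⟨F, hFA, hF, hn⟩ := ih
      obtain ⟨t, htA, ht⟩ := hcon F hFA (hbound F hFA hF)
      obtain ⟨w₀, hw₀⟩ := nonempty_of_measure_ne_zero hμW
      have htF : t ∉ F := fun h => ht t h w₀ hw₀ w₀ hw₀ rfl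
      refine ⟨insert t F, ?_, ?_, by rw [Finset.card_insert_of_notMem htF, hn]⟩
      · rw [Finset.coe_insert]
        exact Set.insert_subset htA hFA
      · rw [Finset.coe_insert]
        refine hF.insert fun s hs _ => Set.disjoint_left.2 fun x hx hx' => ?_
        exact ht s hs (-t + x) hx (-s + x) hx' (by simp)
  obtain ⟨n, hn⟩ := ENNReal.exists_nat_mul_gt hμW hZ
  obtain ⟨F, hFA, hF, rfl⟩ := hall n
  exact absurd (hbound F hFA hF) (not_le.2 hn)

theorem exists_sphere_net (d : ℕ) :
    ∃ F : Finset (E d), (F : Set (E d)) ⊆ S d ∧ (F.card : ℝ) ≤ 9 ^ d ∧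
      ∀ x ∈ S d, ∃ y ∈ F, ‖x - y‖ ≤ 1 / 4 := by
  have hb : ∀ r : ℝ, 0 < r → (volume : Measure (E d)) (Metric.ball 0 r)
      = ENNReal.ofReal (r ^ d) * volume (Metric.ball (0 : E d) 1) := by
    intro r hr
    rw [Measure.addHaar_ball_of_pos _ _ hr]
    simp
  have hpos : (volume : Measure (E d)) (Metric.ball 0 1) ≠ 0 :=
    (Metric.measure_ball_pos _ _ one_pos).ne'
  have hfin : (volume : Measure (E d)) (Metric.ball 0 1) ≠ ⊤ := measure_ball_lt_top.ne
  obtain ⟨F, hFA, hcard, hF⟩ := exists_finset_translates_cover (volume : Measure (E d))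
    (A := S d) (Z := Metric.ball 0 (9 / 8)) (W := Metric.ball 0 (1 / 8))
    Metric.isOpen_ball.measurableSet (Metric.measure_ball_pos _ _ (by norm_num)).ne'
    measure_ball_lt_top.ne (by
      intro t ht w hw
      rw [mem_sphere_zero_iff_norm] at ht
      rw [mem_ball_zero_iff] at hw ⊢
      linarith [norm_add_le t w])
  refine ⟨F, hFA, ?_, fun x hx => ?_⟩
  · rw [hb (1 / 8) (by norm_num), hb (9 / 8) (by norm_num), ← mul_assoc,
      ENNReal.mul_le_mul_iff_left hpos hfin, ← ENNReal.ofReal_natCast,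
      ← ENNReal.ofReal_mul (by positivity), ENNReal.ofReal_le_ofReal_iff (by positivity)] at hcard
    have h : (9 / 8 : ℝ) ^ d = 9 ^ d * (1 / 8) ^ d := by rw [← mul_pow]; norm_num
    rw [h] at hcard
    exact le_of_mul_le_mul_right hcard (by positivity)
  · obtain ⟨s, hs, w, hw, w', hw', h⟩ := hF x hx
    refine ⟨s, hs, ?_⟩
    rw [mem_ball_zero_iff] at hw hw'
    have : x - s = w' - w := by rw [sub_eq_sub_iff_add_eq_add, h, add_comm]
    rw [this]
    linarith [norm_sub_le w' w]

/-- Markov's inequality for the Gaussian `exp (-d‖v‖²/2)` gives `(2πe/d)^(d/2)`, and `2πe < 25`. -/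
theorem volume_ball_le {d : ℕ} (hd : 1 ≤ d) :
    (volume : Measure (E d)).real (Metric.ball 0 1) ≤ (5 / √d) ^ d := by
  have hd0 : (0 : ℝ) < d := by exact_mod_cast hd
  have hint : ∫ v : E d, Real.exp (-((d : ℝ) / 2) * ‖v‖ ^ 2)
      = (Real.pi / ((d : ℝ) / 2)) ^ ((d : ℝ) / 2) := by
    have := GaussianFourier.integral_rexp_neg_mul_sq_norm (V := E d) (b := (d : ℝ) / 2)
      (by positivity)
    simpa using this
  have hi : Integrable fun v : E d => Real.exp (-((d : ℝ) / 2) * ‖v‖ ^ 2) := by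
    by_contra h
    rw [integral_undef h] at hint
    have : 0 < (Real.pi / ((d : ℝ) / 2)) ^ ((d : ℝ) / 2) := by positivity
    linarith
  have h1 := mul_meas_ge_le_integral_of_nonneg (μ := (volume : Measure (E d)))
    (Filter.Eventually.of_forall fun v => (Real.exp_pos _).le) hi (Real.exp (-((d : ℝ) / 2)))
  rw [hint] at h1
  have h2 : (volume : Measure (E d)).real (Metric.ball 0 1) ≤ volume.real
      {v : E d | Real.exp (-((d : ℝ) / 2)) ≤ Real.exp (-((d : ℝ) / 2) * ‖v‖ ^ 2)} := by
    refine measureReal_mono (fun v hv => ?_) ?_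
    · rw [mem_ball_zero_iff] at hv
      rw [Set.mem_ofPred_eq, Real.exp_le_exp]
      have : ‖v‖ ^ 2 ≤ 1 := pow_le_one₀ (norm_nonneg v) hv.le
      nlinarith
    · exact (hi.measure_ge_lt_top (Real.exp_pos _)).ne
  have h3 : (volume : Measure (E d)).real (Metric.ball 0 1)
      ≤ Real.exp ((d : ℝ) / 2) * (Real.pi / ((d : ℝ) / 2)) ^ ((d : ℝ) / 2) := by
    have h4 := (mul_le_mul_of_nonneg_left h2 (Real.exp_pos (-((d : ℝ) / 2))).le).trans h1
    have h5 := mul_le_mul_of_nonneg_left h4 (Real.exp_pos ((d : ℝ) / 2)).le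
    rwa [← mul_assoc, ← Real.exp_add, add_neg_cancel, Real.exp_zero, one_mul] at h5
  refine h3.trans ?_
  have h6 : Real.exp ((d : ℝ) / 2) = Real.exp 1 ^ ((d : ℝ) / 2) := by
    rw [← Real.exp_mul, one_mul]
  have h7 : (5 / √d) ^ d = (25 / (d : ℝ)) ^ ((d : ℝ) / 2) := by
    have : (25 / (d : ℝ)) = (5 / √d) ^ (2 : ℝ) := by
      rw [Real.rpow_two, div_pow, Real.sq_sqrt hd0.le]; norm_num
    rw [this, ← Real.rpow_mul (by positivity), mul_div_cancel₀ _ (by norm_num), Real.rpow_natCast]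
  rw [h6, h7, ← Real.mul_rpow (by positivity) (by positivity)]
  refine Real.rpow_le_rpow (by positivity) ?_ (by positivity)
  have he := Real.exp_one_lt_d9
  have hpi := Real.pi_lt_d2
  have hpi0 := Real.pi_pos
  rw [show Real.exp 1 * (Real.pi / ((d : ℝ) / 2)) = (2 * (Real.exp 1 * Real.pi)) / d by
    field_simp]
  gcongr
  nlinarith

/-! ### Maurey's method and volumes of convex hulls -/

/-- Maurey's empirical method: a point of a convex hull is close to an average of `m` vertices. -/
theorem exists_sym_norm_sub_le {V ι : Type*} [NormedAddCommGroup V] [InnerProductSpace ℝ V]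
    [Fintype ι] (v : ι → V) (hv : ∀ i, ‖v i‖ ≤ 1) (w : ι → ℝ) (hw : ∀ i, 0 ≤ w i)
    (hw1 : ∑ i, w i = 1) (m : ℕ) :
    ∃ s : Sym ι m, ‖((s : Multiset ι).map v).sum - (m : ℝ) • ∑ i, w i • v i‖ ^ 2 ≤ m := by
  set x := ∑ i, w i • v i with hx
  induction m with
  | zero => exact ⟨Sym.nil, by simp⟩
  | succ m ih =>
    obtain ⟨s, hs⟩ := ih
    set y := ((s : Multiset ι).map v).sum - (m : ℝ) • x with hy
    -- Vertices are added greedily: `v i - x` has `w`-mean zero, so the cross term averages out and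
    -- some choice of `i` raises the squared error by at most 1.
    have havg : ∑ i, w i * ‖y + (v i - x)‖ ^ 2 ≤ ∑ i, w i * (m + 1) := by
      have h0 : ∀ i, w i * ‖y + (v i - x)‖ ^ 2
          = w i * ‖y‖ ^ 2 + 2 * inner ℝ (y - x) (w i • v i) - 2 * w i * inner ℝ y x
            + w i * ‖v i‖ ^ 2 + w i * ‖x‖ ^ 2 := by
        intro i
        rw [norm_add_sq_real y, norm_sub_sq_real (v i), inner_sub_right y, inner_smul_right,
          inner_sub_left y, real_inner_comm x (v i)]
        ring
      have h1 : ∑ i, w i * ‖y + (v i - x)‖ ^ 2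
          = ‖y‖ ^ 2 + ∑ i, w i * ‖v i‖ ^ 2 - ‖x‖ ^ 2 := by
        simp_rw [h0, Finset.sum_add_distrib, Finset.sum_sub_distrib, Finset.sum_add_distrib,
          ← Finset.sum_mul, ← Finset.mul_sum, hw1, ← inner_sum, ← hx]
        rw [inner_sub_left, real_inner_self_eq_norm_sq]
        ring
      have h2 : ∑ i, w i * ‖v i‖ ^ 2 ≤ ∑ i, w i := by
        refine Finset.sum_le_sum fun i _ => ?_
        exact mul_le_of_le_one_right (hw i) (pow_le_one₀ (norm_nonneg _) (hv i))
      rw [h1, ← Finset.sum_mul, hw1]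
      nlinarith [sq_nonneg ‖x‖]
    have hex : ∃ i, ‖y + (v i - x)‖ ^ 2 ≤ m + 1 := by
      by_contra! hlt
      have : ∑ i, w i * (m + 1 : ℝ) < ∑ i, w i * ‖y + (v i - x)‖ ^ 2 := by
        obtain ⟨i, -, hi⟩ : ∃ i ∈ Finset.univ, 0 < w i := by
          by_contra! h
          have : ∑ i, w i ≤ 0 := Finset.sum_nonpos h
          linarith
        exact Finset.sum_lt_sum (fun j _ => mul_le_mul_of_nonneg_left (hlt j).le (hw j))
          ⟨i, Finset.mem_univ i, mul_lt_mul_of_pos_left (hlt i) hi⟩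
      linarith
    obtain ⟨i, hi⟩ := hex
    refine ⟨i ::ₛ s, ?_⟩
    have : ((i ::ₛ s : Sym ι (m + 1)) : Multiset ι) = i ::ₘ (s : Multiset ι) := rfl
    rw [this, Multiset.map_cons, Multiset.sum_cons]
    push_cast
    convert hi using 3
    rw [hy]
    module

/-- The hull is covered by balls of radius `1/√m` about the averages of `m`-element multisets of
vertices, which `multichoose` counts. -/
theorem volume_convexHull_le {d : ℕ} (F : Finset (E d)) (hF : ∀ v ∈ F, ‖v‖ ≤ 1) {m : ℕ}
    (hm : 1 ≤ m) :
    volume (convexHull ℝ (F : Set (E d))) ≤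
      ENNReal.ofReal (F.card.multichoose m * (1 / √m) ^ d) * volume (Metric.ball (0 : E d) 1) := by
  classical
  have hm0 : (0 : ℝ) < m := by exact_mod_cast hm
  have hsub : convexHull ℝ (F : Set (E d)) ⊆ ⋃ s : Sym F m,
      Metric.closedBall ((m : ℝ)⁻¹ • ((s : Multiset F).map fun v : F => (v : E d)).sum) (1 / √m) := by
    intro x hx
    rw [Finset.mem_convexHull'] at hx
    obtain ⟨w, hw, hw1, hwx⟩ := hx
    obtain ⟨s, hs⟩ := exists_sym_norm_sub_le (fun v : F => (v : E d)) (fun v => hF v v.2)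
      (fun v => w v) (fun v => hw v v.2) (by rw [← hw1]; exact Finset.sum_coe_sort F w) m
    have hx' : ∑ v : F, w v • (v : E d) = x := by
      rw [← hwx]; exact Finset.sum_coe_sort F fun v => w v • v
    rw [hx'] at hs
    refine Set.mem_iUnion.2 ⟨s, ?_⟩
    rw [Metric.mem_closedBall, dist_comm, dist_eq_norm]
    set z := ((s : Multiset F).map fun v : F => (v : E d)).sum
    have h1 : (m : ℝ)⁻¹ • z - x = (m : ℝ)⁻¹ • (z - (m : ℝ) • x) := by
      rw [smul_sub, smul_smul, inv_mul_cancel₀ hm0.ne', one_smul]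
    have h2 : ‖z - (m : ℝ) • x‖ ≤ √m := Real.le_sqrt_of_sq_le hs
    rw [h1, norm_smul, norm_inv, Real.norm_of_nonneg hm0.le]
    calc (m : ℝ)⁻¹ * ‖z - (m : ℝ) • x‖ ≤ (m : ℝ)⁻¹ * √m := by gcongr
      _ = 1 / √m := by
        rw [inv_mul_eq_div, Real.sqrt_div_self']
  refine (measure_mono hsub).trans ((measure_iUnion_fintype_le _ _).trans ?_)
  have hb : ∀ c : E d, volume (Metric.closedBall c (1 / √m))
      = ENNReal.ofReal ((1 / √m) ^ d) * volume (Metric.ball (0 : E d) 1) := by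
    intro c
    rw [Measure.addHaar_closedBall _ _ (by positivity)]
    simp
  simp_rw [hb]
  rw [Finset.sum_const, Finset.card_univ, Sym.card_sym_eq_multichoose, Fintype.card_coe,
    nsmul_eq_mul, ← mul_assoc, ENNReal.ofReal_mul (by positivity), ENNReal.ofReal_natCast]

/-! ### Volume of operator-norm balls via random matrices -/

/-- The operator with prescribed columns. -/
noncomputable def ofColumns (d : ℕ) : (Fin d → E d) →ₗ[ℝ] (E d →L[ℝ] E d) where
  toFun U := ∑ i, (EuclideanSpace.proj i : E d →L[ℝ] ℝ).smulRight (U i)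
  map_add' U V := by ext1 x; simp [Finset.sum_add_distrib]
  map_smul' c U := by ext1 x; simp [Finset.smul_sum, smul_comm c]

theorem ofColumns_apply {d : ℕ} (U : Fin d → E d) (x : E d) :
    ofColumns d U x = ∑ i, x i • U i := by
  simp [ofColumns]

theorem ofColumns_single {d : ℕ} (U : Fin d → E d) (i : Fin d) :
    ofColumns d U (EuclideanSpace.single i 1) = U i := by
  rw [ofColumns_apply, Finset.sum_eq_single i] <;> simp +contextual

theorem ofColumns_columns {d : ℕ} (T : E d →L[ℝ] E d) :
    ofColumns d (fun i => T (EuclideanSpace.single i 1)) = T := by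
  refine ContinuousLinearMap.coe_injective ((EuclideanSpace.basisFun (Fin d) ℝ).toBasis.ext ?_)
  intro i
  simp [ofColumns_single]

theorem continuous_ofColumns (d : ℕ) : Continuous (ofColumns d) :=
  LinearMap.continuous_of_finiteDimensional _

/-- Moving each of the two arguments of the bilinear form to the net costs at most `‖A‖ / 4`, so
`‖A‖ ≤ τ + ‖A‖ / 2`. -/
theorem opNorm_le_of_net {d : ℕ} {F : Finset (E d)}
    (hF : ∀ x ∈ S d, ∃ y ∈ F, ‖x - y‖ ≤ 1 / 4) (hFS : (F : Set (E d)) ⊆ S d)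
    (A : E d →L[ℝ] E d) {τ : ℝ} (hτ : 0 ≤ τ)
    (h : ∀ y ∈ F, ∀ z ∈ F, inner ℝ y (A z) ≤ τ) : ‖A‖ ≤ 2 * τ := by
  have key : ∀ y ∈ S d, ∀ z ∈ S d, inner ℝ y (A z) ≤ τ + ‖A‖ / 2 := by
    intro y hy z hz
    obtain ⟨y', hy', hyy⟩ := hF y hy
    obtain ⟨z', hz', hzz⟩ := hF z hz
    have hy1 : ‖y'‖ = 1 := mem_sphere_zero_iff_norm.1 (hFS hy')
    have hz1 : ‖z‖ = 1 := mem_sphere_zero_iff_norm.1 hz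
    have h1 : inner ℝ y (A z) = inner ℝ (y - y') (A z) + inner ℝ y' (A (z - z'))
        + inner ℝ y' (A z') := by
      rw [map_sub, inner_sub_left, inner_sub_right]; ring
    have h2 : inner ℝ (y - y') (A z) ≤ 1 / 4 * ‖A‖ := by
      refine (real_inner_le_norm _ _).trans ?_
      have : ‖A z‖ ≤ ‖A‖ := by simpa [hz1] using A.le_opNorm z
      gcongr
    have h3 : inner ℝ y' (A (z - z')) ≤ 1 / 4 * ‖A‖ := by
      refine (real_inner_le_norm _ _).trans ?_
      rw [hy1, one_mul]
      refine (A.le_opNorm _).trans ?_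
      rw [mul_comm]
      gcongr
    linarith [h y' hy' z' hz']
  have hA : ‖A‖ ≤ τ + ‖A‖ / 2 := by
    refine A.opNorm_le_bound (by positivity) fun z => ?_
    rcases eq_or_ne z 0 with rfl | hz
    · simp
    have hz' : 0 < ‖z‖ := norm_pos_iff.2 hz
    rcases eq_or_ne (A z) 0 with h0 | h0
    · rw [h0, norm_zero]; positivity
    have h0' : 0 < ‖A z‖ := norm_pos_iff.2 h0
    have hk := key (‖A z‖⁻¹ • A z) (by simp [norm_smul, h0'.ne'])
      (‖z‖⁻¹ • z) (by simp [norm_smul, hz'.ne'])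
    rw [map_smul, inner_smul_left, inner_smul_right, real_inner_self_eq_norm_sq] at hk
    have : ‖A z‖ = (‖A z‖⁻¹ * (‖z‖⁻¹ * ‖A z‖ ^ 2)) * ‖z‖ := by field_simp
    rw [this]
    refine mul_le_mul_of_nonneg_right ?_ hz'.le
    simpa using hk
  linarith

theorem hasSubgaussianMGF_pi {ι Ω : Type*} [Fintype ι] [MeasurableSpace Ω] (ν : Measure Ω)
    [IsProbabilityMeasure ν] {f : Ω → ℝ} {c : NNReal} (hf : HasSubgaussianMGF f c ν) {x : ι → ℝ}
    (hx : ∑ i, x i ^ 2 = 1) :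
    HasSubgaussianMGF (fun U : ι → Ω => ∑ i, x i * f (U i)) c (Measure.pi fun _ => ν) := by
  have hind : iIndepFun (fun (i : ι) (U : ι → Ω) => x i * f (U i)) (Measure.pi fun _ : ι => ν) :=
    iIndepFun_pi (μ := fun _ : ι => ν) (X := fun i u => x i * f u)
      fun i => hf.aemeasurable.const_mul (x i)
  have hsub : ∀ i, HasSubgaussianMGF (fun U : ι → Ω => x i * f (U i))
      (⟨x i ^ 2, sq_nonneg _⟩ * c) (Measure.pi fun _ : ι => ν) := by
    intro i
    have h1 : HasSubgaussianMGF f c ((Measure.pi fun _ : ι => ν).map (Function.eval i)) := by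
      rwa [(measurePreserving_eval (fun _ : ι => ν) i).map_eq]
    exact (h1.of_map (measurable_pi_apply i).aemeasurable).const_mul (x i)
  have := HasSubgaussianMGF.sum_of_iIndepFun hind (s := Finset.univ) fun i _ => hsub i
  convert this using 1
  refine NNReal.eq ?_
  rw [NNReal.coe_sum]
  change (c : ℝ) = ∑ i, x i ^ 2 * (c : ℝ)
  rw [← Finset.sum_mul, hx, one_mul]

/-- The unit cube of matrices has volume 1, and a matrix with independent entries uniform on `[-1/2,
1/2]` has norm at most `4√d` with probability at least 1/2. -/
theorem half_le_volume_opNorm_le {d : ℕ} (hd : 1 ≤ d) :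
    ENNReal.ofReal (1 / 2) ≤ volume {U : Fin d → E d | ‖ofColumns d U‖ ≤ 4 * √d} := by
  obtain ⟨F, hFS, hFc, hF⟩ := exists_sphere_net d
  have hd0 : (0 : ℝ) < d := by exact_mod_cast hd
  let ν₀ : Measure ℝ := volume.restrict (Set.Icc (-1 / 2) (1 / 2))
  have : IsProbabilityMeasure ν₀ := ⟨by simp [ν₀]; norm_num⟩
  let ν₁ : Measure (Fin d → ℝ) := Measure.pi fun _ => ν₀
  let ν : Measure (Fin d → Fin d → ℝ) := Measure.pi fun _ => ν₁
  have hsub₀ : HasSubgaussianMGF (fun u : ℝ => u) (1 / 4) ν₀ := by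
    have := hasSubgaussianMGF_of_mem_Icc_of_integral_eq_zero (μ := ν₀) (X := fun u : ℝ => u)
      (a := -1 / 2) (b := 1 / 2) aemeasurable_id (ae_restrict_mem measurableSet_Icc) (by
        rw [integral_Icc_eq_integral_Ioc, ← intervalIntegral.integral_of_le (by norm_num),
          integral_id]
        norm_num)
    convert this using 1
    ext
    push_cast
    norm_num
  have hν : ν ≤ volume := by
    have h1 : ν₁ = (volume : Measure (Fin d → ℝ)).restrict
        (Set.univ.pi fun _ => Set.Icc (-1 / 2) (1 / 2)) := by
      rw [volume_pi, Measure.restrict_pi_pi]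
    have h2 : ν = (volume : Measure (Fin d → Fin d → ℝ)).restrict
        (Set.univ.pi fun _ => Set.univ.pi fun _ => Set.Icc (-1 / 2) (1 / 2)) := by
      rw [volume_pi, Measure.restrict_pi_pi, ← h1]
    rw [h2]
    exact Measure.restrict_le_self
  let φ : (Fin d → Fin d → ℝ) → (Fin d → E d) := fun U i => WithLp.toLp 2 (U i)
  have hφ : MeasurePreserving φ volume volume :=
    volume_preserving_pi fun _ : Fin d => PiLp.volume_preserving_toLp (Fin d)
  let B : E d → E d → Set (Fin d → Fin d → ℝ) := fun y z =>
    {U | 2 * √d ≤ ∑ i, z i * ∑ k, y k * U i k}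
  have hB : ∀ y ∈ F, ∀ z ∈ F, ν.real (B y z) ≤ Real.exp (-(8 * d)) := by
    intro y hy z hz
    have hone : ∀ y ∈ F, ∑ k, y k ^ 2 = 1 := by
      intro y hy
      have := mem_sphere_zero_iff_norm.1 (hFS hy)
      rw [← EuclideanSpace.real_norm_sq_eq, this, one_pow]
    -- Unit-vector combinations preserve the sub-Gaussian parameter 1/4: first within a column, then
    -- across columns.
    have h1 := hasSubgaussianMGF_pi ν₀ hsub₀ (hone y hy)
    have h2 := hasSubgaussianMGF_pi ν₁ h1 (hone z hz)
    refine (h2.measure_ge_le (by positivity : 0 ≤ 2 * √d)).trans ?_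
    rw [Real.exp_le_exp, mul_pow, Real.sq_sqrt hd0.le]
    apply le_of_eq
    push_cast
    ring
  have hunion : ν.real (⋃ y ∈ F, ⋃ z ∈ F, B y z) ≤ 1 / 2 := by
    have h1 : ν.real (⋃ y ∈ F, ⋃ z ∈ F, B y z) ≤ ∑ y ∈ F, ∑ z ∈ F, Real.exp (-(8 * d)) :=
      (measureReal_biUnion_finset_le _ _).trans (Finset.sum_le_sum fun y hy =>
        (measureReal_biUnion_finset_le _ _).trans (Finset.sum_le_sum fun z hz => hB y hy z hz))
    refine h1.trans ?_
    rw [Finset.sum_const, Finset.sum_const, nsmul_eq_mul, nsmul_eq_mul]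
    have h2 : Real.exp (-(8 * d)) = (Real.exp (-8)) ^ d := by
      rw [← Real.exp_nat_mul]; ring_nf
    -- There are at most `81^d` pairs of net points, and `162 = 2 * 81`.
    have h3 : Real.exp (-8) ≤ 1 / 162 := by
      rw [Real.exp_neg, ← one_div]
      apply one_div_le_one_div_of_le (by norm_num)
      have : Real.exp 8 = Real.exp 1 ^ 8 := by rw [← Real.exp_nat_mul]; norm_num
      rw [this]
      calc (162 : ℝ) ≤ 2 ^ 8 := by norm_num
        _ ≤ _ := pow_le_pow_left₀ (by norm_num) (by linarith [Real.exp_one_gt_d9]) 8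
    calc (F.card : ℝ) * (F.card * Real.exp (-(8 * d))) ≤ 9 ^ d * (9 ^ d * (1 / 162) ^ d) := by
          rw [h2]; gcongr
      _ = (1 / 2) ^ d := by rw [← mul_pow, ← mul_pow]; norm_num
      _ ≤ 1 / 2 := pow_le_of_le_one (by norm_num) (by norm_num) (by omega)
  have hmeas : MeasurableSet {U : Fin d → E d | ‖ofColumns d U‖ ≤ 4 * √d} :=
    (isClosed_le (continuous_ofColumns d).norm continuous_const).measurableSet
  rw [← hφ.measure_preimage hmeas.nullMeasurableSet]
  have hcompl : (⋃ y ∈ F, ⋃ z ∈ F, B y z)ᶜ ⊆ φ ⁻¹' {U | ‖ofColumns d U‖ ≤ 4 * √d} := by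
    intro U hU
    simp only [Set.mem_compl_iff, Set.mem_iUnion, not_exists] at hU
    have := opNorm_le_of_net hF hFS (ofColumns d (φ U)) (τ := 2 * √d) (by positivity) (by
      intro y hy z hz
      have h := hU y hy z hz
      simp only [B, Set.mem_ofPred_eq, not_le] at h
      refine le_trans (le_of_eq ?_) h.le
      rw [ofColumns_apply, inner_sum]
      refine Finset.sum_congr rfl fun i _ => ?_
      rw [inner_smul_right]
      congr 1
      rw [PiLp.inner_apply]
      refine Finset.sum_congr rfl fun k _ => ?_
      simp [φ, mul_comm])
    rw [Set.mem_preimage, Set.mem_ofPred_eq]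
    linarith
  refine le_trans ?_ ((hν _).trans (measure_mono hcompl))
  have hBm : MeasurableSet (⋃ y ∈ F, ⋃ z ∈ F, B y z) := by
    refine Finset.measurableSet_biUnion _ fun y _ => Finset.measurableSet_biUnion _ fun z _ => ?_
    exact measurableSet_le measurable_const (by fun_prop)
  rw [← ofReal_measureReal (μ := ν), probReal_compl_eq_one_sub hBm]
  exact ENNReal.ofReal_le_ofReal (by linarith)

theorem le_volume_opNorm_le {d : ℕ} (hd : 1 ≤ d) {a : ℝ} (ha : 0 < a) :
    ENNReal.ofReal (1 / 2 * (a / (4 * √d)) ^ (d * d)) ≤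
      volume {U : Fin d → E d | ‖ofColumns d U‖ ≤ a} := by
  have hd0 : (0 : ℝ) < d := by exact_mod_cast hd
  set b := a / (4 * √d) with hb
  have hb0 : 0 < b := by positivity
  have h1 : b • {U : Fin d → E d | ‖ofColumns d U‖ ≤ 4 * √d} ⊆ {U | ‖ofColumns d U‖ ≤ a} := by
    rintro _ ⟨U, hU, rfl⟩
    simp only [Set.mem_ofPred_eq, map_smul, norm_smul, Real.norm_of_nonneg hb0.le] at hU ⊢
    calc b * ‖ofColumns d U‖ ≤ b * (4 * √d) := by gcongr
      _ = a := by rw [hb]; field_simp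
  refine le_trans ?_ (measure_mono h1)
  rw [Measure.addHaar_smul, mul_comm, ENNReal.ofReal_mul (by positivity)]
  have hfr : Module.finrank ℝ (Fin d → E d) = d * d := by
    simp [Module.finrank_pi_fintype]
  rw [hfr, abs_of_nonneg (by positivity)]
  gcongr
  exact half_le_volume_opNorm_le hd

/-! ### The union bound over operators -/

theorem isProbabilityMeasure_sphereUniform {d : ℕ} (hd : 1 ≤ d) :
    IsProbabilityMeasure (sphereUniform d) := by
  refine ⟨?_⟩
  rw [sphereUniform, Measure.smul_apply, smul_eq_mul, Measure.toSphere_apply_univ]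
  refine ENNReal.inv_mul_cancel (mul_ne_zero ?_ (Metric.measure_ball_pos _ _ one_pos).ne')
    (ENNReal.mul_ne_top (ENNReal.natCast_ne_top _) measure_ball_lt_top.ne)
  simp
  omega

/-- Spherical measure is normalized volume of the cone over the set; that cone lies in `T ⁻¹' W`,
whose volume is at most that of `W` because `|T.det| ≥ 1`. -/
theorem sphereUniform_mul_volume_ball_le {d : ℕ} (hd : 1 ≤ d) {W : Set (E d)} (hW : Convex ℝ W)
    (hWc : IsClosed W) (hW0 : (0 : E d) ∈ W) (T : E d →L[ℝ] E d) (hT : 1 ≤ |T.det|) :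
    sphereUniform d {x | T x ∈ W} * volume (Metric.ball (0 : E d) 1) ≤ volume W := by
  have hdE : ((Module.finrank ℝ (E d) : ℕ) : ENNReal) ≠ 0 := by simp; omega
  have hB0 : volume (Metric.ball (0 : E d) 1) ≠ 0 := (Metric.measure_ball_pos _ _ one_pos).ne'
  have hB1 : volume (Metric.ball (0 : E d) 1) ≠ ⊤ := measure_ball_lt_top.ne
  have hmeas : MeasurableSet {x : S d | T x ∈ W} :=
    (hWc.preimage (T.continuous.comp continuous_subtype_val)).measurableSet
  rw [sphereUniform, Measure.smul_apply, smul_eq_mul, Measure.toSphere_apply_univ,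
    Measure.toSphere_apply' _ hmeas]
  have hsub : Set.Ioo (0 : ℝ) 1 • (Subtype.val '' {x : S d | T x ∈ W}) ⊆ T ⁻¹' W := by
    rintro _ ⟨t, ht, _, ⟨x, hx, rfl⟩, rfl⟩
    have := hW.smul_mem_of_zero_mem hW0 hx ⟨ht.1.le, ht.2.le⟩
    simpa using this
  have hpre : volume (T ⁻¹' W) ≤ volume W := by
    rw [Measure.addHaar_preimage_continuousLinearMap _
      (fun h => by rw [show T.det = 0 from h, abs_zero] at hT; linarith)]
    refine mul_le_of_le_one_left zero_le ?_
    rw [abs_inv]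
    exact ENNReal.ofReal_le_one.2 (inv_le_one_of_one_le₀ hT)
  rw [ENNReal.mul_inv (Or.inl hdE) (Or.inr hB0)]
  set D : ENNReal := ((Module.finrank ℝ (E d) : ℕ) : ENNReal)
  set β := volume (Metric.ball (0 : E d) 1)
  set c := volume (Set.Ioo (0 : ℝ) 1 • (Subtype.val '' {x : S d | T x ∈ W}))
  calc D⁻¹ * β⁻¹ * (D * c) * β = (D⁻¹ * D) * (β⁻¹ * β) * c := by ring
    _ = c := by
      rw [ENNReal.inv_mul_cancel hdE (ENNReal.natCast_ne_top _), ENNReal.inv_mul_cancel hB0 hB1]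
      simp
    _ ≤ volume W := (measure_mono hsub).trans hpre

/-- Since `W` contains the ball of radius `s`, perturbing an operator by norm at most `s` moves
images of unit vectors from `W` only into `2 W`. This serves both to bound the size of the net and
to replace `T` by a net element. -/
theorem measure_exists_operator_le {d M : ℕ} (hd : 1 ≤ d) (hdM : d ≤ M) {W : Set (E d)}
    (hW : Convex ℝ W) (hWc : IsClosed W) {s A : ℝ} (hs : 0 < s) (hA : 1 ≤ A)
    (hsW : Metric.closedBall 0 s ⊆ W)
    (hvol : volume W ≤ ENNReal.ofReal ((A * s) ^ d) * volume (Metric.ball (0 : E d) 1)) :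
    Measure.pi (fun _ : Fin M => sphereUniform d)
      {x | ∃ T : E d →L[ℝ] E d, 1 ≤ |T.det| ∧ (∀ i, T (EuclideanSpace.single i 1) ∈ W) ∧
        ∀ j, T (x j) ∈ W} ≤ ENNReal.ofReal ((320 * A ^ 2 * s) ^ (d * M)) := by
  have := isProbabilityMeasure_sphereUniform hd
  have hd0 : (0 : ℝ) < d := by exact_mod_cast hd
  have hsd : 0 < √(d : ℝ) := Real.sqrt_pos.2 hd0
  have hB0 : volume (Metric.ball (0 : E d) 1) ≠ 0 := (Metric.measure_ball_pos _ _ one_pos).ne'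
  have hB1 : volume (Metric.ball (0 : E d) 1) ≠ ⊤ := measure_ball_lt_top.ne
  have hB2 : volume (Metric.ball (0 : E d) 1) ≤ ENNReal.ofReal ((5 / √d) ^ d) := by
    rw [← ofReal_measureReal]
    exact ENNReal.ofReal_le_ofReal (volume_ball_le hd)
  set W₂ : Set (E d) := (2 : ℝ) • W with hW₂
  have hadd : ∀ x ∈ W, ∀ y ∈ W, x + y ∈ W₂ := by
    intro x hx y hy
    refine ⟨(1 / 2 : ℝ) • x + (1 / 2 : ℝ) • y,
      hW hx hy (by norm_num) (by norm_num) (by norm_num), ?_⟩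
    simp only [smul_add, smul_smul]
    norm_num
  have hW₂vol : volume W₂ ≤
      ENNReal.ofReal ((2 * A * s) ^ d) * volume (Metric.ball (0 : E d) 1) := by
    rw [hW₂, Measure.addHaar_smul, finrank_euclideanSpace_fin, abs_of_nonneg (by positivity)]
    refine (mul_le_mul_right hvol _).trans (le_of_eq ?_)
    rw [← mul_assoc, ← ENNReal.ofReal_mul (by positivity), ← mul_pow, ← mul_assoc]
  obtain ⟨F, hFA, hFc, hF⟩ := exists_finset_translates_cover
    (volume : Measure (Fin d → E d))
    (A := {U | 1 ≤ |(ofColumns d U).det| ∧ ∀ i, U i ∈ W}) (Z := Set.univ.pi fun _ => W₂)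
    (W := {U | ‖ofColumns d U‖ ≤ s / 2})
    (isClosed_le (continuous_ofColumns d).norm continuous_const).measurableSet
    ((lt_of_lt_of_le (ENNReal.ofReal_pos.2 (by positivity))
      (le_volume_opNorm_le hd (half_pos hs))).ne') (by
      rw [volume_pi_pi]
      refine ENNReal.prod_ne_top fun i _ => (lt_of_le_of_lt hW₂vol ?_).ne
      exact ENNReal.mul_lt_top ENNReal.ofReal_lt_top measure_ball_lt_top) (by
      intro U hU V hV i _
      refine hadd _ (hU.2 i) _ (hsW ?_)
      rw [mem_closedBall_zero_iff, ← ofColumns_single V i]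
      refine ((ofColumns d V).le_opNorm _).trans ?_
      rw [PiLp.norm_single, norm_one, mul_one]
      exact le_trans hV (by linarith))
  have hcard : (F.card : ℝ) ≤ 2 * (80 * A) ^ (d * d) := by
    have h1 : ENNReal.ofReal (F.card * (1 / 2 * (s / 2 / (4 * √d)) ^ (d * d))) ≤
        ENNReal.ofReal (((2 * A * s) ^ d * (5 / √d) ^ d) ^ d) := by
      rw [ENNReal.ofReal_mul (by positivity), ENNReal.ofReal_natCast]
      refine (mul_le_mul_right (le_volume_opNorm_le hd (half_pos hs)) _).trans (hFc.trans ?_)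
      rw [volume_pi_pi, Finset.prod_const, Finset.card_univ, Fintype.card_fin,
        ENNReal.ofReal_pow (by positivity)]
      refine pow_le_pow_left' (hW₂vol.trans ?_) d
      rw [ENNReal.ofReal_mul (by positivity)]
      gcongr
    rw [ENNReal.ofReal_le_ofReal_iff (by positivity), ← mul_pow, ← pow_mul] at h1
    have h2 : (2 * A * s * (5 / √d)) ^ (d * d)
        = (80 * A) ^ (d * d) * (s / 2 / (4 * √d)) ^ (d * d) := by
      rw [← mul_pow]
      congr 1
      field_simp
      norm_num
    rw [h2, ← mul_assoc] at h1
    have := le_of_mul_le_mul_right h1 (by positivity)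
    linarith
  have hone : ∀ U ∈ F, Measure.pi (fun _ : Fin M => sphereUniform d)
      {x | ∀ j, ofColumns d U (x j) ∈ W₂} ≤ ENNReal.ofReal ((2 * A * s) ^ (d * M)) := by
    intro U hU
    have h1 : {x : Fin M → S d | ∀ j, ofColumns d U (x j) ∈ W₂}
        = Set.univ.pi fun _ => {x : S d | ofColumns d U x ∈ W₂} := by
      ext x; simp
    rw [h1, Measure.pi_pi, Finset.prod_const, Finset.card_univ, Fintype.card_fin, pow_mul,
      ENNReal.ofReal_pow (by positivity)]
    refine pow_le_pow_left' ?_ M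
    have h2 := (sphereUniform_mul_volume_ball_le hd (hW.smul 2)
      (hWc.smul_of_ne_zero two_ne_zero) ⟨0, hsW (by simp [hs.le]), by simp⟩ (ofColumns d U)
      (hFA hU).1).trans hW₂vol
    exact (ENNReal.mul_le_mul_iff_left hB0 hB1).1 h2
  have hcover : {x : Fin M → S d | ∃ T : E d →L[ℝ] E d, 1 ≤ |T.det| ∧
      (∀ i, T (EuclideanSpace.single i 1) ∈ W) ∧ ∀ j, T (x j) ∈ W} ⊆
      ⋃ U ∈ F, {x | ∀ j, ofColumns d U (x j) ∈ W₂} := by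
    rintro x ⟨T, hT, hTe, hTx⟩
    obtain ⟨U, hUF, V, hV, V', hV', h⟩ := hF (fun i => T (EuclideanSpace.single i 1))
      ⟨by rwa [ofColumns_columns], hTe⟩
    refine Set.mem_iUnion₂.2 ⟨U, hUF, fun j => ?_⟩
    have h1 : ofColumns d U = T + (ofColumns d V - ofColumns d V') := by
      have := congrArg (ofColumns d) h
      rw [map_add, map_add, ofColumns_columns] at this
      rw [← add_sub_assoc, this, add_sub_cancel_right]
    rw [h1, add_apply]
    refine hadd _ (hTx j) _ (hsW ?_)
    rw [mem_closedBall_zero_iff]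
    refine (ContinuousLinearMap.le_opNorm _ _).trans ?_
    rw [mem_sphere_zero_iff_norm.1 (x j).2, mul_one]
    refine (norm_sub_le _ _).trans ?_
    rw [Set.mem_ofPred_eq] at hV hV'
    linarith
  refine (measure_mono hcover).trans ((measure_biUnion_finset_le _ _).trans
    ((Finset.sum_le_sum hone).trans ?_))
  rw [Finset.sum_const, nsmul_eq_mul, ← ENNReal.ofReal_natCast,
    ← ENNReal.ofReal_mul (by positivity)]
  refine ENNReal.ofReal_le_ofReal ?_
  have hdM' : d * d ≤ d * M := Nat.mul_le_mul_left d hdM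
  have hdM0 : d * M ≠ 0 := by
    have : 0 < d * M := Nat.mul_pos hd (hd.trans hdM)
    omega
  -- Since `80 * A ≥ 1` and `d ≤ M`, the entropy factor is absorbed into a power `d * M`.
  calc (F.card : ℝ) * (2 * A * s) ^ (d * M)
      ≤ 2 * (80 * A) ^ (d * d) * (2 * A * s) ^ (d * M) := by gcongr
    _ ≤ 2 ^ (d * M) * (80 * A) ^ (d * M) * (2 * A * s) ^ (d * M) := by
        gcongr
        · exact le_self_pow₀ one_le_two hdM0
        · linarith
    _ = (320 * A ^ 2 * s) ^ (d * M) := by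
        rw [← mul_pow, ← mul_pow]
        congr 1
        ring

theorem multichoose_le (n : ℕ) {m : ℕ} (hm : 1 ≤ m) :
    (n.multichoose m : ℝ) ≤ (Real.exp 1 * (n + m) / m) ^ m := by
  have hm0 : (0 : ℝ) < m := by exact_mod_cast hm
  have h1 : (n.multichoose m : ℝ) ≤ (n + m : ℝ) ^ m / m.factorial := by
    rw [Nat.multichoose_eq]
    refine (Nat.choose_le_pow_div m (n + m - 1)).trans ?_
    gcongr
    have : n + m - 1 ≤ n + m := Nat.sub_le _ _
    exact_mod_cast this
  have h2 : (m : ℝ) ^ m / m.factorial ≤ Real.exp m :=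
    Real.pow_div_factorial_le_exp _ hm0.le m
  calc (n.multichoose m : ℝ) ≤ (n + m : ℝ) ^ m / m.factorial := h1
    _ = ((n + m : ℝ) / m) ^ m * ((m : ℝ) ^ m / m.factorial) := by
        rw [div_pow]; field_simp
    _ ≤ ((n + m : ℝ) / m) ^ m * Real.exp m := by gcongr
    _ = _ := by
        rw [← mul_one (m : ℝ), Real.exp_nat_mul, ← mul_pow]
        congr 1
        rw [mul_one]
        ring

/-- The generating points of the Gluskin polytope, before symmetrization. -/
def vertices {d M : ℕ} (N : Fin (numBlocks d M) → Finset (E d)) (x : Fin M → S d) : Set (E d) :=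
  (Set.range fun i : Fin d => EuclideanSpace.single i (1 : ℝ)) ∪
    (⋃ k, (N k : Set (E d))) ∪ Set.range fun j => (x j : E d)

/-! ### Block parameters and the volume of the polytope -/

section

variable {d M : ℕ}

theorem one_half_le_log (hd : 1 ≤ d) (hM : 2 * d ≤ M) : 1 / 2 ≤ Real.log ((M : ℝ) / d) := by
  have hd0 : (0 : ℝ) < d := by exact_mod_cast hd
  have h2 : (2 : ℝ) ≤ M / d := by
    rw [le_div_iff₀ hd0]
    exact_mod_cast hM
  have := Real.log_le_log (by norm_num) h2
  linarith [Real.log_two_gt_d9]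

theorem log_le (hd : 1 ≤ d) (hM : 2 * d ≤ M) (hMe : (M : ℝ) ≤ Real.exp d) :
    Real.log ((M : ℝ) / d) ≤ d := by
  have hd0 : (1 : ℝ) ≤ d := by exact_mod_cast hd
  have hM0 : (0 : ℝ) < M := by
    have : 0 < M := by omega
    exact_mod_cast this
  rw [Real.log_le_iff_le_exp (by positivity)]
  exact (div_le_self hM0.le hd0).trans hMe

theorem log_five_le_two : Real.log 5 ≤ 2 := by
  rw [Real.log_le_iff_le_exp (by norm_num)]
  have : Real.exp 2 = Real.exp 1 ^ 2 := by rw [← Real.exp_nat_mul]; norm_num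
  rw [this]
  nlinarith [Real.exp_one_gt_d9]

theorem one_le_log_five : 1 ≤ Real.log 5 := by
  rw [Real.le_log_iff_exp_le (by norm_num)]
  linarith [Real.exp_one_lt_d9]

theorem one_le_blockLength (hd : 1 ≤ d) (hM : 2 * d ≤ M) : 1 ≤ blockLength d M := by
  refine Nat.one_le_ceil_iff.2 ?_
  have := one_half_le_log hd hM
  have := one_le_log_five
  exact div_pos (by linarith) (by linarith)

theorem blockLength_le (hd : 1 ≤ d) (hM : 2 * d ≤ M) (hMe : (M : ℝ) ≤ Real.exp d) :
    blockLength d M ≤ d := by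
  refine Nat.ceil_le.2 ?_
  rw [Real.logb, div_le_iff₀ (by linarith [one_le_log_five])]
  have := one_le_log_five
  have := log_le hd hM hMe
  have : (0 : ℝ) ≤ d := by positivity
  nlinarith

theorem log_div_two_le_blockLength (hd : 1 ≤ d) (hM : 2 * d ≤ M) :
    Real.log ((M : ℝ) / d) / 2 ≤ blockLength d M := by
  refine le_trans ?_ (Nat.le_ceil _)
  have := one_half_le_log hd hM
  have := one_le_log_five
  exact div_le_div_of_nonneg_left (by linarith) (by linarith) log_five_le_two

theorem five_pow_blockLength_le (hd : 1 ≤ d) (hM : 2 * d ≤ M) :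
    (5 : ℝ) ^ blockLength d M ≤ 5 * (M / d) := by
  have hd0 : (0 : ℝ) < d := by exact_mod_cast hd
  have hM0 : (0 : ℝ) < M := by
    have : 0 < M := by omega
    exact_mod_cast this
  have hpos : 0 ≤ Real.logb 5 ((M : ℝ) / d) := by
    have := one_half_le_log hd hM
    have := one_le_log_five
    exact div_nonneg (by linarith) (by linarith)
  have h1 := (Nat.ceil_lt_add_one hpos).le
  calc (5 : ℝ) ^ blockLength d M = (5 : ℝ) ^ ((blockLength d M : ℕ) : ℝ) :=
        (Real.rpow_natCast _ _).symm
    _ ≤ (5 : ℝ) ^ (Real.logb 5 ((M : ℝ) / d) + 1) :=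
        Real.rpow_le_rpow_of_exponent_le (by norm_num) h1
    _ = 5 * (M / d) := by
        rw [Real.rpow_add_one (by norm_num), Real.rpow_logb (by norm_num) (by norm_num)
          (by positivity), mul_comm]

theorem numBlocks_le (hd : 1 ≤ d) (hM : 2 * d ≤ M) : numBlocks d M ≤ d := by
  refine Nat.ceil_le.2 (div_le_self (by positivity) ?_)
  exact_mod_cast one_le_blockLength hd hM

theorem numBlocks_le_four_mul (hd : 1 ≤ d) (hM : 2 * d ≤ M) (hMe : (M : ℝ) ≤ Real.exp d) :
    (numBlocks d M : ℝ) ≤ 4 * (d / Real.log ((M : ℝ) / d)) := by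
  have hL := one_half_le_log hd hM
  have hl := log_div_two_le_blockLength hd hM
  have hl0 : (0 : ℝ) < blockLength d M := by linarith
  have hld : (blockLength d M : ℝ) ≤ d := by exact_mod_cast blockLength_le hd hM hMe
  have h1 : (1 : ℝ) ≤ d / blockLength d M := (one_le_div hl0).2 hld
  have h2 : (d : ℝ) / blockLength d M ≤ d / (Real.log ((M : ℝ) / d) / 2) :=
    div_le_div_of_nonneg_left (by positivity) (by linarith) hl
  have h3 : (d : ℝ) / (Real.log ((M : ℝ) / d) / 2) = 2 * (d / Real.log ((M : ℝ) / d)) := by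
    field_simp
  have h4 := (Nat.ceil_lt_add_one (by positivity : 0 ≤ (d : ℝ) / blockLength d M)).le
  rw [show numBlocks d M = ⌈(d : ℝ) / blockLength d M⌉₊ from rfl]
  linarith

variable {N : Fin (numBlocks d M) → Finset (E d)}

theorem norm_vertices (hN : IsNetFamily d M N) (x : Fin M → S d) :
    ∀ v ∈ vertices N x, ‖v‖ = 1 := by
  rintro v ((⟨i, rfl⟩ | hv) | ⟨j, rfl⟩)
  · simp
  · obtain ⟨k, hk⟩ := Set.mem_iUnion.1 hv
    exact mem_sphere_zero_iff_norm.1 (hN.subset k hk).1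
  · exact mem_sphere_zero_iff_norm.1 (x j).2

/-- At most `d` blocks with `5^ℓ ≤ 5 M / d` points each give `5 M` net points; with the basis and
the `x j` this is at most `7 M`, doubled by signs. -/
theorem exists_finset_polytope (hd : 1 ≤ d) (hM : 2 * d ≤ M) (hN : IsNetFamily d M N)
    (x : Fin M → S d) :
    ∃ F : Finset (E d), (∀ v ∈ F, ‖v‖ ≤ 1) ∧ F.card ≤ 14 * M ∧
      polytope N x = convexHull ℝ (F : Set (E d)) := by
  classical
  let G : Finset (E d) := (Finset.univ.image fun i : Fin d => EuclideanSpace.single i (1 : ℝ)) ∪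
    (Finset.univ.biUnion N) ∪ Finset.univ.image fun j => (x j : E d)
  have hG : (G : Set (E d)) = vertices N x := by
    simp [G, vertices, Set.union_assoc]
  have hGc : G.card ≤ 7 * M := by
    have h1 : (Finset.univ.biUnion N).card ≤ 5 * M := by
      have h2 : (Finset.univ.biUnion N).card ≤ numBlocks d M * 5 ^ blockLength d M := by
        refine Finset.card_biUnion_le.trans ((Finset.sum_le_sum fun k _ => hN.card_le k).trans ?_)
        simp
      have hd0 : (0 : ℝ) < d := by exact_mod_cast hd
      have h3 : (d : ℝ) * 5 ^ blockLength d M ≤ 5 * M := by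
        refine (mul_le_mul_of_nonneg_left (five_pow_blockLength_le hd hM) hd0.le).trans
          (le_of_eq ?_)
        field_simp
      have h4 : d * 5 ^ blockLength d M ≤ 5 * M := by exact_mod_cast h3
      exact h2.trans ((Nat.mul_le_mul_right _ (numBlocks_le hd hM)).trans h4)
    have h5 : (Finset.univ.image fun i : Fin d => EuclideanSpace.single i (1 : ℝ)).card ≤ d :=
      Finset.card_image_le.trans (by simp)
    have h6 : (Finset.univ.image fun j => (x j : E d)).card ≤ M :=
      Finset.card_image_le.trans (by simp)
    have h7 := Finset.card_union_le
      (Finset.univ.image fun i : Fin d => EuclideanSpace.single i (1 : ℝ)) (Finset.univ.biUnion N)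
    have h8 : G.card ≤ _ := Finset.card_union_le _ _
    omega
  have hG1 : ∀ v ∈ G, ‖v‖ ≤ 1 := fun v hv => (norm_vertices hN x v (hG ▸ hv)).le
  refine ⟨G ∪ G.image Neg.neg, ?_, ?_, ?_⟩
  · intro v hv
    rcases Finset.mem_union.1 hv with hv | hv
    · exact hG1 v hv
    · obtain ⟨w, hw, rfl⟩ := Finset.mem_image.1 hv
      rw [norm_neg]
      exact hG1 w hw
  · have h1 := Finset.card_union_le G (G.image Neg.neg)
    have h2 : (G.image Neg.neg).card ≤ G.card := Finset.card_image_le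
    omega
  · rw [Finset.coe_union, Finset.coe_image, hG]
    change absconv (vertices N x) = _
    rw [absconv]
    congr 2
    ext v
    simp

theorem convex_polytope (x : Fin M → S d) : Convex ℝ (polytope N x) := convex_convexHull _ _

theorem isCompact_polytope (hd : 1 ≤ d) (hM : 2 * d ≤ M) (hN : IsNetFamily d M N)
    (x : Fin M → S d) : IsCompact (polytope N x) := by
  obtain ⟨F, -, -, hF⟩ := exists_finset_polytope hd hM hN x
  rw [hF]
  exact F.finite_toSet.isCompact_convexHull ℝ

theorem vertices_subset_polytope (x : Fin M → S d) : vertices N x ⊆ polytope N x :=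
  Set.subset_union_left.trans (subset_convexHull _ _)

theorem polytope_subset {W : Set (E d)} (hW : Convex ℝ W) (hWn : ∀ v ∈ W, -v ∈ W)
    {x : Fin M → S d} (h : vertices N x ⊆ W) : polytope N x ⊆ W :=
  convexHull_min (Set.union_subset h fun v hv => by simpa using hWn _ (h hv)) hW

theorem neg_mem_polytope (x : Fin M → S d) {v : E d} (hv : v ∈ polytope N x) :
    -v ∈ polytope N x := by
  have h1 : polytope N x ⊆ Neg.neg ⁻¹' polytope N x := by
    have hc : Convex ℝ (-polytope N x) := (convex_polytope x).neg
    refine convexHull_min ?_ hc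
    rintro w (hw | hw)
    · exact subset_convexHull _ _ (Or.inr (by simpa using hw))
    · exact subset_convexHull _ _ (Or.inl hw)
  exact h1 hv

theorem polytope_subset_closedBall (hN : IsNetFamily d M N) (x : Fin M → S d) :
    polytope N x ⊆ Metric.closedBall 0 1 :=
  polytope_subset (convex_closedBall _ _) (fun v hv => by simpa using hv)
    fun v hv => by simp [norm_vertices hN x v hv]

theorem volume_polytope_le (hd : 1 ≤ d) (hM : 2 * d ≤ M) (hMe : (M : ℝ) ≤ Real.exp d)
    (hN : IsNetFamily d M N) (x : Fin M → S d) :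
    volume (polytope N x) ≤
      ENNReal.ofReal ((Real.exp 16 * √(Real.log ((M : ℝ) / d) / d)) ^ d) *
        volume (Metric.ball (0 : E d) 1) := by
  obtain ⟨F, hF1, hFc, hF⟩ := exists_finset_polytope hd hM hN x
  set L := Real.log ((M : ℝ) / d) with hL
  have hL2 : 1 / 2 ≤ L := one_half_le_log hd hM
  have hLd : L ≤ d := log_le hd hM hMe
  have hd0 : (0 : ℝ) < d := by exact_mod_cast hd
  have hM0 : (2 : ℝ) * d ≤ M := by exact_mod_cast hM
  have hdL : 1 ≤ d / L := (one_le_div (by linarith)).2 hLd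
  -- This size makes Maurey's radius at most `√(L/d)` while the number of averages stays exponential
  -- in `d`.
  set m := ⌈(d : ℝ) / L⌉₊ with hm
  have hm1 : (d : ℝ) / L ≤ m := Nat.le_ceil _
  have hm2 : (m : ℝ) ≤ 2 * (d / L) := by
    have := (Nat.ceil_lt_add_one (by linarith : 0 ≤ (d : ℝ) / L)).le
    linarith
  have hm0 : (0 : ℝ) < m := by linarith
  have hm3 : 1 ≤ m := by exact_mod_cast (Nat.cast_pos.1 hm0 : 0 < m)
  rw [hF]
  refine (volume_convexHull_le F hF1 hm3).trans ?_
  gcongr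
  rw [mul_pow]
  have hr : 1 / √(m : ℝ) ≤ √(L / d) := by
    rw [one_div, ← Real.sqrt_inv]
    refine Real.sqrt_le_sqrt ?_
    rw [← inv_div]
    exact inv_anti₀ (by linarith) hm1
  have hmc : (F.card.multichoose m : ℝ) ≤ Real.exp 16 ^ d := by
    refine (multichoose_le F.card hm3).trans ?_
    have hq : Real.exp L = M / d := Real.exp_log (by
      have : (0 : ℝ) < M := by linarith
      positivity)
    -- The factors `16`, `e`, `M / d` and `L` are at most `exp L` to the powers 4, 2, 1 and 1.
    have hbase : Real.exp 1 * (F.card + m) / m ≤ Real.exp (8 * L) := by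
      have hdL' : 0 < d / L := by linarith
      have h1 : ((F.card : ℝ) + m) ≤ 16 * M := by
        have : (F.card : ℝ) ≤ 14 * M := by exact_mod_cast hFc
        have : (d : ℝ) / L ≤ d / (1 / 2) :=
          div_le_div_of_nonneg_left hd0.le (by norm_num) hL2
        have : (d : ℝ) / (1 / 2) = 2 * d := by ring
        linarith
      have h2 : Real.exp 1 * (F.card + m) / m ≤ Real.exp 1 * (16 * M) / (d / L) := by
        have : (0 : ℝ) ≤ M := by linarith
        gcongr
      have h3 : Real.exp 1 * (16 * M) / (d / L) = 16 * Real.exp 1 * (M / d) * L := by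
        field_simp
      have h4 : (2 : ℝ) ≤ Real.exp L := by
        rw [hq, le_div_iff₀ hd0]; exact hM0
      have h5 : L ≤ Real.exp L := by linarith [Real.add_one_le_exp L]
      have h6 : Real.exp 1 ≤ Real.exp L ^ 2 := by
        rw [← Real.exp_nat_mul]
        exact Real.exp_le_exp.2 (by push_cast; linarith)
      calc Real.exp 1 * (F.card + m) / m ≤ 16 * Real.exp 1 * (M / d) * L := h2.trans h3.le
        _ = 2 ^ 4 * Real.exp 1 * Real.exp L * L := by rw [hq]; norm_num
        _ ≤ Real.exp L ^ 4 * Real.exp L ^ 2 * Real.exp L * Real.exp L := by gcongr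
        _ = Real.exp L ^ 8 := by ring
        _ = Real.exp (8 * L) := by rw [← Real.exp_nat_mul]; norm_num
    calc (Real.exp 1 * (F.card + m) / m) ^ m ≤ Real.exp (8 * L) ^ m := by gcongr
      _ = Real.exp (m * (8 * L)) := by rw [← Real.exp_nat_mul]
      _ ≤ Real.exp (d * 16) := by
          refine Real.exp_le_exp.2 ?_
          calc (m : ℝ) * (8 * L) ≤ 2 * (d / L) * (8 * L) := by
                have : 0 ≤ 8 * L := by linarith
                gcongr
            _ = d * 16 := by
                have : L ≠ 0 := by linarith
                field_simp
                norm_num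
      _ = Real.exp 16 ^ d := by rw [← Real.exp_nat_mul]
  gcongr

end

/-! ### The inscribed ball -/

section

variable {d M : ℕ} {N : Fin (numBlocks d M) → Finset (E d)}

/-- The index of the block containing a coordinate. -/
noncomputable def blockIndex (hd : 1 ≤ d) (hM : 2 * d ≤ M) (i : Fin d) : Fin (numBlocks d M) :=
  ⟨i / blockLength d M, by
    have hl : (0 : ℝ) < blockLength d M := by exact_mod_cast one_le_blockLength hd hM
    refine Nat.lt_ceil.2 (lt_of_le_of_lt Nat.cast_div_le ?_)
    have : ((i : ℕ) : ℝ) < d := by exact_mod_cast i.2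
    gcongr⟩

theorem blockIndex_eq_iff (hd : 1 ≤ d) (hM : 2 * d ≤ M) (i : Fin d) (k : Fin (numBlocks d M)) :
    blockIndex hd hM i = k ↔ i ∈ block d M k := by
  rw [Fin.ext_iff]
  change (i : ℕ) / blockLength d M = (k : ℕ) ↔
    (k : ℕ) * blockLength d M ≤ (i : ℕ) ∧ (i : ℕ) < ((k : ℕ) + 1) * blockLength d M
  have hl : 0 < blockLength d M := one_le_blockLength hd hM
  rw [← Nat.le_div_iff_mul_le hl, ← Nat.div_lt_iff_lt_mul hl]
  omega

/-- By pigeonhole over at most `4 d / L` blocks, some block restriction `u` of `y` has norm at least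
`√(L/d) / 2 * ‖y‖`; a net point near the direction of `u` retains half of that. -/
theorem exists_vertex_inner_ge (hd : 1 ≤ d) (hM : 2 * d ≤ M) (hMe : (M : ℝ) ≤ Real.exp d)
    (hN : IsNetFamily d M N) (x : Fin M → S d) {y : E d} (hy : y ≠ 0) :
    ∃ v ∈ vertices N x,
      √(Real.log ((M : ℝ) / d) / d) / 4 * ‖y‖ ≤ inner ℝ y v := by
  classical
  have hy0 : 0 < ‖y‖ := norm_pos_iff.2 hy
  set L := Real.log ((M : ℝ) / d) with hL
  have hL2 : 1 / 2 ≤ L := one_half_le_log hd hM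
  have hd0 : (0 : ℝ) < d := by exact_mod_cast hd
  set r := √(L / d) with hr
  have hr0 : 0 < r := Real.sqrt_pos.2 (by positivity)
  have hr2 : r ^ 2 = L / d := Real.sq_sqrt (by positivity)
  let κ := blockIndex hd hM
  have hsum : ∑ k, ∑ i with κ i = k, y i ^ 2 = ‖y‖ ^ 2 := by
    rw [Finset.sum_fiberwise, EuclideanSpace.real_norm_sq_eq]
  have hnb : (numBlocks d M : ℝ) * (r ^ 2 / 4 * ‖y‖ ^ 2) ≤ ‖y‖ ^ 2 := by
    have h1 := numBlocks_le_four_mul hd hM hMe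
    calc (numBlocks d M : ℝ) * (r ^ 2 / 4 * ‖y‖ ^ 2)
        ≤ 4 * (d / L) * (r ^ 2 / 4 * ‖y‖ ^ 2) := by gcongr
      _ = ‖y‖ ^ 2 := by rw [hr2]; field_simp
  obtain ⟨k, -, hk⟩ : ∃ k ∈ (Finset.univ : Finset (Fin (numBlocks d M))),
      r ^ 2 / 4 * ‖y‖ ^ 2 ≤ ∑ i with κ i = k, y i ^ 2 := by
    refine Finset.exists_le_of_sum_le ⟨κ ⟨0, hd⟩, Finset.mem_univ _⟩ ?_
    rw [hsum]
    simpa using hnb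
  let u : E d := WithLp.toLp 2 fun i => if κ i = k then y i else 0
  have hu2 : ‖u‖ ^ 2 = ∑ i with κ i = k, y i ^ 2 := by
    rw [EuclideanSpace.real_norm_sq_eq, Finset.sum_filter]
    refine Finset.sum_congr rfl fun i _ => ?_
    by_cases h : κ i = k <;> simp [u, h]
  have hu : r / 2 * ‖y‖ ≤ ‖u‖ := by
    refine abs_le_of_sq_le_sq' ?_ (norm_nonneg u) |>.2
    rw [hu2]
    refine le_trans (le_of_eq ?_) hk
    ring
  have hu0 : 0 < ‖u‖ := lt_of_lt_of_le (by positivity) hu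
  have huS : ‖u‖⁻¹ • u ∈ coordSphere (block d M k) := by
    refine ⟨mem_sphere_zero_iff_norm.2 (by simp [norm_smul, hu0.ne']), fun i hi => ?_⟩
    have : ¬ κ i = k := fun h => hi ((blockIndex_eq_iff hd hM i k).1 h)
    simp [u, this]
  obtain ⟨z, hz, hzd⟩ := hN.net k _ huS
  refine ⟨z, Or.inl (Or.inr (Set.mem_iUnion.2 ⟨k, hz⟩)), ?_⟩
  have hzS := hN.subset k hz
  have hz1 : ‖z‖ = 1 := mem_sphere_zero_iff_norm.1 hzS.1
  have hyz : inner ℝ y z = inner ℝ u z := by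
    rw [PiLp.inner_apply, PiLp.inner_apply]
    refine Finset.sum_congr rfl fun i _ => ?_
    by_cases h : κ i = k
    · simp [u, h]
    · have h0 := hzS.2 i fun hi => h ((blockIndex_eq_iff hd hM i k).2 hi)
      simp [h0]
  have hin : 1 / 2 ≤ inner ℝ (‖u‖⁻¹ • u) z := by
    rw [dist_eq_norm] at hzd
    have h1 : ‖‖u‖⁻¹ • u - z‖ ^ 2 ≤ (1 / 2) ^ 2 := by gcongr
    rw [norm_sub_sq_real, hz1, mem_sphere_zero_iff_norm.1 huS.1] at h1
    linarith
  rw [inner_smul_left] at hin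
  have h2 : ‖u‖ * (1 / 2) ≤ ‖u‖ * (‖u‖⁻¹ * inner ℝ u z) :=
    mul_le_mul_of_nonneg_left (by simpa using hin) hu0.le
  rw [mul_inv_cancel_left₀ hu0.ne'] at h2
  rw [hyz]
  linarith

/-- Hahn–Banach: the preceding bound is a lower bound on the support function. -/
theorem closedBall_subset_polytope (hd : 1 ≤ d) (hM : 2 * d ≤ M) (hMe : (M : ℝ) ≤ Real.exp d)
    (hN : IsNetFamily d M N) (x : Fin M → S d) :
    Metric.closedBall 0 (√(Real.log ((M : ℝ) / d) / d) / 4) ⊆ polytope N x := by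
  intro p hp
  by_contra hpx
  obtain ⟨f, c, hfc, hcp⟩ := geometric_hahn_banach_closed_point (convex_polytope (N := N) x)
    (isCompact_polytope hd hM hN x).isClosed hpx
  set y := (InnerProductSpace.toDual ℝ (E d)).symm f with hy
  have hf : ∀ z, f z = inner ℝ y z := fun z => by
    rw [hy, InnerProductSpace.toDual_symm_apply]
  have hy0 : y ≠ 0 := by
    intro h
    have h0 := hfc _ (vertices_subset_polytope x (Or.inl (Or.inl ⟨⟨0, hd⟩, rfl⟩)))
    rw [hf, h, inner_zero_left] at h0 hcp
    linarith
  obtain ⟨v, hv, hyv⟩ := exists_vertex_inner_ge hd hM hMe hN x hy0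
  have h1 := hfc v (vertices_subset_polytope x hv)
  rw [hf] at h1 hcp
  have h2 := real_inner_le_norm y p
  rw [mem_closedBall_zero_iff] at hp
  have h3 : ‖y‖ * ‖p‖ ≤ ‖y‖ * (√(Real.log ((M : ℝ) / d) / d) / 4) := by gcongr
  linarith

end

/-! ### From Banach–Mazur distance to linear embeddings -/

/-- Two symmetric bodies that are close to a common body: each of them is mapped by a linear
isomorphism, respectively its inverse, into a multiple of the other. -/
theorem exists_map_subset_smul {d : ℕ} {V V' K : Set (E d)} (hV : Convex ℝ V)
    (hVn : ∀ v ∈ V, -v ∈ V) {lam : ℝ} {T T' : E d ≃ₗ[ℝ] E d}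
    {a b a' b' : E d} (h : (fun x => T' (x - b')) '' K ⊆ (fun x => lam • (x - a)) '' V)
    (hV'n : ∀ v ∈ V', -v ∈ V') (h' : (fun x => x - a') '' V' ⊆ (fun x => T (x - b)) '' K) :
    ∀ v ∈ V', ∃ w ∈ V, T' (T.symm v) = lam • w := by
  have key : ∀ v ∈ V', ∃ w ∈ V,
      T' (T.symm v) = lam • w + (T' (T.symm a') + T' b' - T' b - lam • a) := by
    intro v hv
    obtain ⟨k, hk, hkv⟩ := h' ⟨v, hv, rfl⟩
    obtain ⟨w, hw, hwk⟩ := h ⟨k, hk, rfl⟩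
    refine ⟨w, hw, ?_⟩
    simp only at hkv hwk
    have h1 : T.symm v = k - b + T.symm a' := by
      rw [sub_eq_iff_eq_add.1 hkv.symm, map_add, LinearEquiv.symm_apply_apply]
    have h2 : T' k - T' b' = lam • w - lam • a := by
      rw [← map_sub, ← hwk, smul_sub]
    rw [h1, map_add, map_sub, sub_eq_iff_eq_add.1 h2]
    abel
  intro v hv
  obtain ⟨w, hw, hwv⟩ := key v hv
  obtain ⟨w', hw', hwv'⟩ := key (-v) (hV'n v hv)
  -- Halving the difference of the relations for `v` and `-v` cancels the common translation.
  refine ⟨(1 / 2 : ℝ) • w + (1 / 2 : ℝ) • (-w'),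
    hV hw (hVn _ hw') (by norm_num) (by norm_num) (by norm_num), ?_⟩
  rw [map_neg, map_neg] at hwv'
  have h3 : T' (T.symm v) = (1 / 2 : ℝ) • (T' (T.symm v) - -(T' (T.symm v))) := by module
  rw [h3]
  nth_rewrite 1 [hwv]
  rw [hwv']
  module

theorem exists_banachMazur_lt {d : ℕ} {V K : Set (E d)} (hVb : V ⊆ Metric.closedBall 0 1)
    {s : ℝ} (hs : 0 < s) (hsV : Metric.closedBall 0 s ⊆ V) (hK : IsConvexBody K) {D : ℝ}
    (hD : banachMazurDist V K < D) :
    ∃ lam, 0 < lam ∧ lam < D ∧ ∃ (T : E d ≃ₗ[ℝ] E d) (a b : E d),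
      (fun x => x - a) '' V ⊆ (fun x => T (x - b)) '' K ∧
      (fun x => T (x - b)) '' K ⊆ (fun x => lam • (x - a)) '' V := by
  -- The real `sInf` of the empty set is 0, so nonemptiness is needed to extract an admissible
  -- `lam`.
  have hne : {lam : ℝ | 0 < lam ∧ ∃ (T : E d ≃ₗ[ℝ] E d) (a b : E d),
      (fun x => x - a) '' V ⊆ (fun x => T (x - b)) '' K ∧
      (fun x => T (x - b)) '' K ⊆ (fun x => lam • (x - a)) '' V}.Nonempty := by
    obtain ⟨b, hb⟩ := hK.interior_nonempty
    obtain ⟨ε, hε, hεK⟩ := Metric.nhds_basis_closedBall.mem_iff.1 (mem_interior_iff_mem_nhds.1 hb)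
    obtain ⟨R, hR⟩ := hK.isCompact.isBounded.subset_closedBall b
    set R' := max R 1
    have hR' : 0 < R' := lt_of_lt_of_le one_pos (le_max_right _ _)
    refine ⟨ε⁻¹ * R' / s, by positivity,
      LinearEquiv.smulOfNeZero ℝ (E d) ε⁻¹ (by positivity), 0, b, ?_, ?_⟩
    · rintro _ ⟨v, hv, rfl⟩
      refine ⟨b + ε • v, hεK ?_, ?_⟩
      · have := mem_closedBall_zero_iff.1 (hVb hv)
        rw [Metric.mem_closedBall, dist_self_add_left, norm_smul, Real.norm_of_nonneg hε.le]
        nlinarith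
      · simp [smul_smul, hε.ne']
    · rintro _ ⟨k, hk, rfl⟩
      refine ⟨(s / R') • (k - b), hsV ?_, ?_⟩
      · have h1 : ‖k - b‖ ≤ R' := by
          have := hR hk
          rw [mem_closedBall_iff_norm] at this
          exact this.trans (le_max_left _ _)
        rw [mem_closedBall_zero_iff, norm_smul, Real.norm_of_nonneg (by positivity)]
        calc s / R' * ‖k - b‖ ≤ s / R' * R' := by gcongr
          _ = s := by field_simp
      · simp only [sub_zero, smul_smul, LinearEquiv.smulOfNeZero_apply]
        congr 1
        field_simp
  obtain ⟨lam, ⟨h0, h⟩, hlt⟩ := exists_lt_of_csInf_lt hne hD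
  exact ⟨lam, h0, hlt, h⟩

/-! ### Pairs of polytopes and the product measure -/

section

variable {d M : ℕ} {N : Fin (numBlocks d M) → Finset (E d)}

/-- A functional strictly separating a point from the polytope still separates after small moves of
the point and of the finitely many `x j`. -/
theorem isClosed_setOf_mem_polytope (hd : 1 ≤ d) (hM : 2 * d ≤ M) (hN : IsNetFamily d M N) :
    IsClosed {z : (Fin M → S d) × E d | z.2 ∈ polytope N z.1} := by
  rw [← isOpen_compl_iff, isOpen_iff_mem_nhds]
  rintro ⟨x₀, q₀⟩ hq₀
  obtain ⟨f, c, hfc, hcq⟩ := geometric_hahn_banach_closed_point (convex_polytope (N := N) x₀)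
    (isCompact_polytope hd hM hN x₀).isClosed hq₀
  have hvert : ∀ v ∈ vertices N x₀, |f v| < c := by
    intro v hv
    have hv' := vertices_subset_polytope x₀ hv
    rw [abs_lt]
    have := hfc _ (neg_mem_polytope x₀ hv')
    rw [map_neg] at this
    exact ⟨by linarith, hfc v hv'⟩
  have hopen : IsOpen {z : (Fin M → S d) × E d | (∀ j, |f (z.1 j)| < c) ∧ c < f z.2} := by
    have hq : IsOpen {z : (Fin M → S d) × E d | c < f z.2} :=
      isOpen_lt continuous_const (f.continuous.comp continuous_snd)
    refine IsOpen.inter ?_ hq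
    have : {z : (Fin M → S d) × E d | ∀ j, |f (z.1 j)| < c}
        = ⋂ j, {z : (Fin M → S d) × E d | |f (z.1 j)| < c} := by ext; simp
    change IsOpen {z : (Fin M → S d) × E d | ∀ j, |f (z.1 j)| < c}
    rw [this]
    exact isOpen_iInter_of_finite fun j => isOpen_lt (by fun_prop) continuous_const
  refine Filter.mem_of_superset (hopen.mem_nhds ⟨fun j => hvert _ (Or.inr ⟨j, rfl⟩), hcq⟩) ?_
  rintro ⟨x, q⟩ ⟨hx, hq⟩ hqx
  have hconv : Convex ℝ {v : E d | |f v| < c} := by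
    have : {v : E d | |f v| < c} = f ⁻¹' Set.Ioo (-c) c := by ext; simp [abs_lt]
    rw [this]
    exact (convex_Ioo _ _).linear_preimage f.toLinearMap
  have hsub : polytope N x ⊆ {v : E d | |f v| < c} := by
    refine polytope_subset hconv (fun v hv => by simpa using hv) ?_
    rintro v (hv | ⟨j, rfl⟩)
    · exact hvert v (Or.inl hv)
    · exact hx j
  have h1 : |f q| < c := hsub hqx
  have h2 : c < f q := hq
  linarith [(abs_lt.1 h1).2]

/-- The pairs of sphere vertices for which some operator of determinant at least one in absolute
value maps the first polytope's distinguished vertices into `ρ` times the second polytope. -/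
def embeddingPairs (N : Fin (numBlocks d M) → Finset (E d)) (ρ : ℝ) :
    Set ((Fin M → S d) × (Fin M → S d)) :=
  {p | ∃ T : E d →L[ℝ] E d, 1 ≤ |T.det| ∧
    (∀ i, T (EuclideanSpace.single i 1) ∈ ρ • polytope N p.2) ∧
    ∀ j, T (p.1 j) ∈ ρ • polytope N p.2}

/-- Columns in `ρ • polytope` bound `T`, so the set is the projection of a compact set of triples,
hence closed. Measurability is needed to integrate over sections. -/
theorem measurableSet_embeddingPairs (hd : 1 ≤ d) (hM : 2 * d ≤ M) (hN : IsNetFamily d M N)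
    {ρ : ℝ} (hρ : 0 < ρ) : MeasurableSet (embeddingPairs N ρ) := by
  let H : Set (((Fin M → S d) × (Fin M → S d)) × (E d →L[ℝ] E d)) :=
    {z | 1 ≤ |z.2.det|} ∩
      ((⋂ i, {z | z.2 (EuclideanSpace.single i 1) ∈ ρ • polytope N z.1.2}) ∩
      ⋂ j, {z | z.2 (z.1.1 j) ∈ ρ • polytope N z.1.2})
  have hmem : ∀ g : ((Fin M → S d) × (Fin M → S d)) × (E d →L[ℝ] E d) → E d, Continuous g →
      IsClosed {z | g z ∈ ρ • polytope N z.1.2} := by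
    intro g hg
    have h1 : {z | g z ∈ ρ • polytope N z.1.2}
        = (fun z => (z.1.2, ρ⁻¹ • g z)) ⁻¹'
          {z : (Fin M → S d) × E d | z.2 ∈ polytope N z.1} := by
      ext z
      exact Set.mem_smul_set_iff_inv_smul_mem₀ hρ.ne' _ _
    rw [h1]
    exact (isClosed_setOf_mem_polytope hd hM hN).preimage (by fun_prop)
  have hHc : IsClosed H := by
    refine IsClosed.inter ?_ (IsClosed.inter ?_ ?_)
    · refine isClosed_le continuous_const (Continuous.abs ?_)
      exact ContinuousLinearMap.continuous_det.comp continuous_snd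
    · exact isClosed_iInter fun i => hmem _ (by fun_prop)
    · exact isClosed_iInter fun j => hmem _ (by fun_prop)
  have hHb : H ⊆ Set.univ ×ˢ Metric.closedBall 0 (d * ρ) := by
    rintro ⟨p, T⟩ ⟨-, hT, -⟩
    refine ⟨Set.mem_univ _, ?_⟩
    rw [mem_closedBall_zero_iff]
    refine T.opNorm_le_bound (by positivity) fun x => ?_
    have hcol : ∀ i, ‖T (EuclideanSpace.single i 1)‖ ≤ ρ := by
      intro i
      obtain ⟨v, hv, hvT⟩ := Set.mem_iInter.1 hT i
      change ρ • v = T (EuclideanSpace.single i 1) at hvT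
      have := mem_closedBall_zero_iff.1 (polytope_subset_closedBall hN _ hv)
      rw [← hvT, norm_smul, Real.norm_of_nonneg hρ.le]
      exact mul_le_of_le_one_right hρ.le this
    rw [← ofColumns_columns T, ofColumns_apply]
    calc ‖∑ i, x i • T (EuclideanSpace.single i 1)‖ ≤ ∑ _i : Fin d, ‖x‖ * ρ := by
          refine norm_sum_le_of_le _ fun i _ => ?_
          rw [norm_smul]
          exact mul_le_mul (PiLp.norm_apply_le x i) (hcol i) (norm_nonneg _) (norm_nonneg _)
      _ = d * ρ * ‖x‖ := by simp; ring
  have : ProperSpace (E d →L[ℝ] E d) := FiniteDimensional.proper ℝ _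
  have hHk : IsCompact H :=
    (isCompact_univ.prod (isCompact_closedBall 0 ((d : ℝ) * ρ))).of_isClosed_subset hHc hHb
  have himg : embeddingPairs N ρ = Prod.fst '' H := by
    ext p
    constructor
    · rintro ⟨T, h1, h2, h3⟩
      exact ⟨(p, T), ⟨h1, Set.mem_iInter.2 h2, Set.mem_iInter.2 h3⟩, rfl⟩
    · rintro ⟨⟨p, T⟩, ⟨h1, h2, h3⟩, rfl⟩
      exact ⟨T, h1, Set.mem_iInter.1 h2, Set.mem_iInter.1 h3⟩
  rw [himg]
  exact (hHk.image continuous_fst).isClosed.measurableSet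

theorem mem_embeddingPairs_or_swap (hd : 1 ≤ d) (hM : 2 * d ≤ M) (hMe : (M : ℝ) ≤ Real.exp d)
    (hN : IsNetFamily d M N) {K : Set (E d)} (hK : IsConvexBody K) {ρ : ℝ} {x x' : Fin M → S d}
    (hx : banachMazurDist (polytope N x) K < ρ) (hx' : banachMazurDist (polytope N x') K < ρ) :
    (x, x') ∈ embeddingPairs N ρ ∨ (x', x) ∈ embeddingPairs N ρ := by
  have hs : 0 < √(Real.log ((M : ℝ) / d) / d) / 4 := by
    have := one_half_le_log hd hM
    have hd0 : (0 : ℝ) < d := by exact_mod_cast hd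
    positivity
  have h0 : ∀ x : Fin M → S d, (0 : E d) ∈ polytope N x := fun x =>
    closedBall_subset_polytope hd hM hMe hN x (Metric.mem_closedBall_self hs.le)
  have key : ∀ {x x' : Fin M → S d} (Φ : E d ≃ₗ[ℝ] E d) {lam : ℝ}, 0 < lam → lam < ρ →
      (∀ v ∈ polytope N x, ∃ w ∈ polytope N x', Φ v = lam • w) →
      1 ≤ |LinearMap.det (Φ : E d →ₗ[ℝ] E d)| → (x, x') ∈ embeddingPairs N ρ := by
    intro x x' Φ lam hlam hlamρ hΦ hdet
    have hmap : ∀ v ∈ vertices N x, Φ v ∈ ρ • polytope N x' := by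
      intro v hv
      obtain ⟨w, hw, hwv⟩ := hΦ v (vertices_subset_polytope x hv)
      have hρ : 0 < ρ := hlam.trans hlamρ
      refine ⟨(lam / ρ) • w, (convex_polytope x').smul_mem_of_zero_mem (h0 x') hw
        ⟨by positivity, (div_le_one hρ).2 hlamρ.le⟩, ?_⟩
      rw [hwv]
      change ρ • ((lam / ρ) • w) = lam • w
      rw [smul_smul, mul_div_cancel₀ _ hρ.ne']
    exact ⟨LinearMap.toContinuousLinearMap (Φ : E d →ₗ[ℝ] E d), hdet,
      fun i => hmap _ (Or.inl (Or.inl ⟨i, rfl⟩)), fun j => hmap _ (Or.inr ⟨j, rfl⟩)⟩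
  obtain ⟨lam, hlam, hlamρ, T, a, b, h1, h2⟩ := exists_banachMazur_lt
    (polytope_subset_closedBall hN x) hs (closedBall_subset_polytope hd hM hMe hN x) hK hx
  obtain ⟨lam', hlam', hlamρ', T', a', b', h1', h2'⟩ := exists_banachMazur_lt
    (polytope_subset_closedBall hN x') hs (closedBall_subset_polytope hd hM hMe hN x') hK hx'
  have hA := exists_map_subset_smul (convex_polytope x') (fun v => neg_mem_polytope x') h2'
    (fun v => neg_mem_polytope x) h1
  have hB := exists_map_subset_smul (convex_polytope x) (fun v => neg_mem_polytope x) h2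
    (fun v => neg_mem_polytope x') h1'
  -- The two maps are mutually inverse, so their determinants cannot both be less than 1 in absolute
  -- value.
  have hdet := LinearEquiv.det_mul_det_symm (T.symm.trans T')
  by_cases hge : 1 ≤ |LinearMap.det ((T.symm.trans T' : E d ≃ₗ[ℝ] E d) : E d →ₗ[ℝ] E d)|
  · exact Or.inl (key (T.symm.trans T') hlam' hlamρ' hA hge)
  · refine Or.inr (key (T'.symm.trans T) hlam hlamρ hB ?_)
    have h3 := congrArg abs hdet
    rw [abs_mul, abs_one] at h3
    change |_| * |LinearMap.det ((T'.symm.trans T : E d ≃ₗ[ℝ] E d) : E d →ₗ[ℝ] E d)| = 1 at h3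
    by_contra! hlt
    have := mul_lt_one_of_nonneg_of_lt_one_left (abs_nonneg _) (not_le.1 hge) hlt.le
    linarith

theorem measure_section_embeddingPairs_le (hd : 1 ≤ d) (hM : 2 * d ≤ M)
    (hMe : (M : ℝ) ≤ Real.exp d) (hN : IsNetFamily d M N) {ρ s : ℝ} (hρ : 0 < ρ)
    (hs : s = ρ * (√(Real.log ((M : ℝ) / d) / d) / 4)) (x' : Fin M → S d) :
    Measure.pi (fun _ : Fin M => sphereUniform d) {x | (x, x') ∈ embeddingPairs N ρ} ≤
      ENNReal.ofReal ((320 * (4 * Real.exp 16) ^ 2 * s) ^ (d * M)) := by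
  have hr : 0 < √(Real.log ((M : ℝ) / d) / d) := by
    have := one_half_le_log hd hM
    have hd0 : (0 : ℝ) < d := by exact_mod_cast hd
    positivity
  refine measure_exists_operator_le hd (by omega) ((convex_polytope x').smul ρ)
    ((isCompact_polytope hd hM hN x').smul ρ).isClosed (by rw [hs]; positivity)
    -- Here `A = 4 * exp 16`, the 4 coming from the 1/4 in the inradius.
    (by linarith [Real.add_one_le_exp 16]) ?_ ?_
  · intro p hp
    rw [Set.mem_smul_set_iff_inv_smul_mem₀ hρ.ne']
    refine closedBall_subset_polytope hd hM hMe hN x' ?_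
    rw [mem_closedBall_zero_iff] at hp ⊢
    rw [norm_smul, norm_inv, Real.norm_of_nonneg hρ.le, inv_mul_le_iff₀ hρ, ← hs]
    exact hp
  · rw [Measure.addHaar_smul, finrank_euclideanSpace_fin, abs_of_nonneg (by positivity)]
    refine (mul_le_mul_right (volume_polytope_le hd hM hMe hN x') _).trans (le_of_eq ?_)
    rw [← mul_assoc, ← ENNReal.ofReal_mul (by positivity), ← mul_pow, hs]
    congr 3
    ring

theorem measure_banachMazurDist_lt_le (hd : 1 ≤ d) (hM : 2 * d ≤ M)
    (hMe : (M : ℝ) ≤ Real.exp d) (hN : IsNetFamily d M N) {ρ s : ℝ} (hρ : 0 < ρ)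
    (hs : s = ρ * (√(Real.log ((M : ℝ) / d) / d) / 4)) {K : Set (E d)} (hK : IsConvexBody K) :
    Measure.pi (fun _ : Fin M => sphereUniform d)
      {x | banachMazurDist (polytope N x) K < ρ} ^ 2 ≤
      2 * ENNReal.ofReal ((320 * (4 * Real.exp 16) ^ 2 * s) ^ (d * M)) := by
  have := isProbabilityMeasure_sphereUniform hd
  set μ := Measure.pi (fun _ : Fin M => sphereUniform d) with hμ
  set ε := ENNReal.ofReal ((320 * (4 * Real.exp 16) ^ 2 * s) ^ (d * M))
  set A := {x | banachMazurDist (polytope N x) K < ρ}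
  have hsec := measure_section_embeddingPairs_le hd hM hMe hN hρ hs
  have hmeas := measurableSet_embeddingPairs hd hM hN hρ
  have h1 : (μ.prod μ) (embeddingPairs N ρ) ≤ ε := by
    rw [Measure.prod_apply_symm hmeas]
    refine (lintegral_mono hsec).trans (le_of_eq ?_)
    rw [lintegral_const, measure_univ, mul_one]
  have h2 : (μ.prod μ) (Prod.swap ⁻¹' embeddingPairs N ρ) ≤ ε := by
    rw [Measure.prod_apply (measurable_swap hmeas)]
    refine (lintegral_mono hsec).trans (le_of_eq ?_)
    rw [lintegral_const, measure_univ, mul_one]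
  have hsub : A ×ˢ A ⊆ embeddingPairs N ρ ∪ Prod.swap ⁻¹' embeddingPairs N ρ := by
    rintro ⟨x, x'⟩ ⟨hx, hx'⟩
    exact mem_embeddingPairs_or_swap hd hM hMe hN hK hx hx'
  calc μ A ^ 2 = (μ.prod μ) (A ×ˢ A) := by rw [Measure.prod_prod, sq]
    _ ≤ ε + ε := (measure_mono hsub).trans ((measure_union_le _ _).trans (add_le_add h1 h2))
    _ = 2 * ε := (two_mul ε).symm

end

end Gluskin

/-! ### Choice of the constant and conclusion -/

theorem corollary2p3 :
    ∃ C : ℝ, 0 < C ∧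
      ∀ (d M : ℕ), 1 ≤ d → 2 * d ≤ M → (M : ℝ) ≤ Real.exp d →
      ∀ N : Fin (Gluskin.numBlocks d M) → Finset (Gluskin.E d), Gluskin.IsNetFamily d M N →
      ∀ (Ω : Type*) [MeasurableSpace Ω] (P : Measure Ω) [IsProbabilityMeasure P]
        (X : Fin M → Ω → Gluskin.S d),
        (∀ j, HasLaw (X j) (Gluskin.sphereUniform d) P) → iIndepFun X P →
      ∀ K : Set (Gluskin.E d), Gluskin.IsConvexBody K →
        P.real {ω | Gluskin.banachMazurDist (Gluskin.polytope N fun j => X j ω) K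
            ≤ C * √((d : ℝ) / Real.log ((M : ℝ) / d))}
          ≤ √2 * Real.exp (-((d : ℝ) * M) / 2) := by
  set κ : ℝ := 320 * (4 * Real.exp 16) ^ 2 with hκ
  have hκ0 : 0 < κ := by positivity
  -- With `ρ = 2 * D`, this makes `κ * s = exp (-1)`. Doubling `D` turns the non-strict bound on the
  -- distance into the strict one used above.
  refine ⟨2 * (Real.exp (-1) / κ), by positivity, ?_⟩
  intro d M hd hM hMe N hN Ω _ P _ X hX hindep K hK
  have hd0 : (0 : ℝ) < d := by exact_mod_cast hd
  have hL := Gluskin.one_half_le_log hd hM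
  set L := Real.log ((M : ℝ) / d)
  have hL0 : 0 < L := by linarith
  set D := 2 * (Real.exp (-1) / κ) * √((d : ℝ) / L) with hD
  have hD0 : 0 < D := by positivity
  have hs : Real.exp (-1) / κ = (2 * D) * (√(L / d) / 4) := by
    have h1 : √((d : ℝ) / L) * √(L / d) = 1 := by
      rw [← Real.sqrt_mul (by positivity), div_mul_div_cancel₀ hL0.ne', div_self hd0.ne',
        Real.sqrt_one]
    calc Real.exp (-1) / κ = Real.exp (-1) / κ * (√((d : ℝ) / L) * √(L / d)) := by
          rw [h1, mul_one]
      _ = _ := by rw [hD]; ring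
  have hmain := Gluskin.measure_banachMazurDist_lt_le hd hM hMe hN (by positivity) hs hK
  rw [← hκ, mul_div_cancel₀ _ hκ0.ne'] at hmain
  have := Gluskin.isProbabilityMeasure_sphereUniform hd
  have hYm : AEMeasurable (fun ω j => X j ω) P :=
    aemeasurable_pi_lambda _ fun j => (hX j).aemeasurable
  have hlaw : P.map (fun ω j => X j ω) =
      Measure.pi (fun _ : Fin M => Gluskin.sphereUniform d) := by
    rw [(iIndepFun_iff_map_fun_eq_pi_map fun j => (hX j).aemeasurable).1 hindep]
    congr 1
    ext1 j
    exact (hX j).map_eq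
  have hle : P {ω | Gluskin.banachMazurDist (Gluskin.polytope N fun j => X j ω) K ≤ D} ≤
      Measure.pi (fun _ : Fin M => Gluskin.sphereUniform d)
        {x | Gluskin.banachMazurDist (Gluskin.polytope N x) K < 2 * D} := by
    rw [← hlaw]
    refine le_trans (measure_mono fun ω hω => ?_) (Measure.le_map_apply hYm _)
    have hω' : Gluskin.banachMazurDist (Gluskin.polytope N fun j => X j ω) K ≤ D := hω
    exact lt_of_le_of_lt hω' (by linarith)
  have hsq : P.real {ω | Gluskin.banachMazurDist (Gluskin.polytope N fun j => X j ω) K ≤ D} ^ 2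
      ≤ 2 * Real.exp (-1) ^ (d * M) := by
    have h1 := (pow_le_pow_left' hle 2).trans hmain
    rw [← ofReal_measureReal, ← ENNReal.ofReal_pow measureReal_nonneg,
      ← ENNReal.ofReal_ofNat, ← ENNReal.ofReal_mul (by norm_num),
      ENNReal.ofReal_le_ofReal_iff (by positivity)] at h1
    exact h1
  refine abs_le_of_sq_le_sq' (hsq.trans (le_of_eq ?_)) (by positivity) |>.2
  rw [mul_pow, Real.sq_sqrt (by norm_num), ← Real.exp_nat_mul, ← Real.exp_nat_mul]
  congr 2
  push_cast
  ring
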